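/- Let $V$ and $H$ be separable real Hilbert spaces with $V$ densely embedded in $H$, normalised so that $\|v\|_H\le\|v\|_V$ for $v\in V$, let $V'$ be the dual of $V$ (so $V\subset H\subset V'$), and let $T>0$. Let $a(t,\cdot,\cdot)=a_0(t,\cdot,\cdot)+a_1(t,\cdot,\cdot)$, $t\in[0,T]$, be continuous bilinear forms on $V$ such that for all $u,v\in V$ and $t\in[0,T]$: (i) $t\mapsto a_0(t,u,v)$ is continuously differentiable on $[0,T]$; $C_0,C_0'\ge 0$ are constants with $|a_0(t,u,v)|\le C_0\|u\|_V\|v\|_V$ and $|\tfrac{d}{dt}a_0(t,u,v)|\le C_0'\|u\|_V\|v\|_V$; (ii) $a_0(t,u,v)=a_0(t,v,u)$; (iii) $a_0(t,u,u)\ge\mu\|u\|_V^2-\lambda\|u\|_H^2$ with constants $\lambda,\mu>0$; (iv) $t\mapsto a_1(t,u,v)$ is continuous on $[0,T]$; (v) $|a_1(t,u,v)|\le C_1\|u\|_V\|v\|_H$ with a constant $C_1\ge0$. Let $L$ map $L^2(0,T;H)$ to itself and let $C_L>0$ be such that $\|Lu\|_{L^2(0,T_1;H)}\le C_L\|u\|_{L^2(0,T_1;H)}$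 for all $u\in L^2(0,T;H)$ and all $T_1\in(0,T]$. Let $f_1\in V$, $f_2\in H$, $h\in L^2(0,T;H)$, and let $u\in L^2(0,T;V)$, with distributional derivatives $u'\in L^2(0,T;V)$ and $u''\in L^2(0,T;V')$, satisfy $$\langle u''(t),v\rangle+a(t,u(t),v)+\langle Lu(t),v\rangle=\langle h(t),v\rangle\quad\text{for all }v\in V\text{ and a.e. }t\in(0,T),$$ $$u(0)=f_1,\qquad u'(0)=f_2,$$ where the initial values are those of the continuous representatives of $u$ in $V$ and of $u'$ in $V'$. Then $u\in C([0,T];V)$ and $u'\in C([0,T];H)$ (after modification on a null set), and for every $t\in[0,T]$ $$\|u(t)\|_V^2+\|u'(t)\|_H^2\le\Big(D_T\|f_1\|_V^2+\frac1\nu\Big(\|f_2\|_H^2+\int_0^t\|h(\tau)\|_H^2\,d\tau\Big)\Big)e^{tF_T},$$ where $\nu=\min\{1,\mu\}$, $D_T=\dfrac{C_0+\lambda(1+T)}{\nu}$ and $F_T=\max\Big\{\dfrac{C_0'+C_1+C_L^2}{\nu},\ \dfrac{C_1+2+\lambda(1+T)}{\nu}\Big\}$. -/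

import Mathlib

open MeasureTheory Set
open scoped ContDiff

/-- The Bochner space `L²(0,T;X)`. -/
abbrev BochnerL2 (T : ℝ) (X : Type*) [NormedAddCommGroup X] : Type _ :=
  Lp X 2 (volume.restrict (Ioo (0 : ℝ) T))

/-- `w` is the distributional derivative of `u` on `(0,T)`:
`∫ φ' u = - ∫ φ w` for all test functions `φ ∈ C_c^∞((0,T))`. -/
def HasDistribDeriv (T : ℝ) {X : Type*} [NormedAddCommGroup X] [NormedSpace ℝ X]
    (u w : ℝ → X) : Prop :=
  ∀ φ : ℝ → ℝ, ContDiff ℝ ∞ φ → HasCompactSupport φ → tsupport φ ⊆ Ioo 0 T →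
    ∫ t in Ioo 0 T, deriv φ t • u t = -∫ t in Ioo 0 T, φ t • w t

/-- `g` is continuous on `[0,T]` and agrees with `u` almost everywhere on `(0,T)`. -/
def IsContRepr (T : ℝ) {X : Type*} [TopologicalSpace X] (g u : ℝ → X) : Prop :=
  ContinuousOn g (Icc 0 T) ∧ ∀ᵐ t ∂(volume.restrict (Ioo (0 : ℝ) T)), g t = u t

section

variable {V H : Type*} [NormedAddCommGroup V] [InnerProductSpace ℝ V]
  [NormedAddCommGroup H] [InnerProductSpace ℝ H]

/-- `ι` is a dense embedding of `V` into `H`, normalised so that `‖v‖_H ≤ ‖v‖_V`. -/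
structure IsGelfandEmbedding (ι : V →L[ℝ] H) : Prop where
  injective : Function.Injective ι
  dense : DenseRange ι
  norm_le : ∀ v, ‖ι v‖ ≤ ‖v‖

/-- The embedding `H ⊂ V'` of the Gelfand triple: `x ↦ (v ↦ ⟨x, v⟩_H)`. -/
noncomputable def toDualOf (ι : V →L[ℝ] H) (x : H) : StrongDual ℝ V :=
  (innerSL ℝ x).comp ι

/-- The conditions on the bilinear forms `a = a₀ + a₁`, with all their constants.
`bound₀'` concerns the time derivative `a₀'` (one-sided at the end points of `[0,T]`). -/
structure IsAdmissibleForm (T : ℝ) (ι : V →L[ℝ] H) (a₀ a₁ : ℝ → V →L[ℝ] V →L[ℝ] ℝ)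
    (lam μ C₀ C₀' C₁ : ℝ) : Prop where
  contDiff₀ : ∀ u v, ContDiffOn ℝ 1 (fun t => a₀ t u v) (Icc 0 T)
  symm₀ : ∀ t ∈ Icc 0 T, ∀ u v, a₀ t u v = a₀ t v u
  lam_pos : 0 < lam
  mu_pos : 0 < μ
  coercive : ∀ t ∈ Icc 0 T, ∀ u, μ * ‖u‖ ^ 2 - lam * ‖ι u‖ ^ 2 ≤ a₀ t u u
  continuous₁ : ∀ u v, ContinuousOn (fun t => a₁ t u v) (Icc 0 T)
  C₁_nonneg : 0 ≤ C₁
  bound₁ : ∀ t ∈ Icc 0 T, ∀ u v, |a₁ t u v| ≤ C₁ * ‖u‖ * ‖ι v‖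
  C₀_nonneg : 0 ≤ C₀
  bound₀ : ∀ t ∈ Icc 0 T, ∀ u v, |a₀ t u v| ≤ C₀ * ‖u‖ * ‖v‖
  C₀'_nonneg : 0 ≤ C₀'
  bound₀' : ∀ t ∈ Icc 0 T, ∀ u v,
    |derivWithin (fun s => a₀ s u v) (Icc 0 T) t| ≤ C₀' * ‖u‖ * ‖v‖

/-- `‖L u‖_{L²(0,T₁;H)} ≤ C_L ‖u‖_{L²(0,T₁;H)}` for all `T₁ ≤ T`, with `C_L` independent
of `T₁` and `u`. -/
def CausalBound (T : ℝ) (L : BochnerL2 T H → BochnerL2 T H) (CL : ℝ) : Prop :=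
  ∀ T₁ ∈ Ioc 0 T, ∀ u : BochnerL2 T H,
    eLpNorm (L u) 2 (volume.restrict (Ioo (0 : ℝ) T₁)) ≤
      ENNReal.ofReal CL * eLpNorm u 2 (volume.restrict (Ioo (0 : ℝ) T₁))

/-- `u ∈ L²(0,T;V)`, with distributional derivatives `u' ∈ L²(0,T;V)` and
`u'' ∈ L²(0,T;V')`, solves
`⟨u''(t),v⟩ + a₀(t,u(t),v) + a₁(t,u(t),v) + ⟨(Lu)(t),v⟩ = ⟨h(t),v⟩` for all `v ∈ V` and
almost every `t ∈ (0,T)`, with `u(0) = f₁` and `u'(0) = f₂`. The initial values are those of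
the continuous representatives of `u` (in `V`) and of `u'` (in `V'`). -/
structure IsAbstractSolution (T : ℝ) (ι : V →L[ℝ] H) (a₀ a₁ : ℝ → V →L[ℝ] V →L[ℝ] ℝ)
    (L : BochnerL2 T H → BochnerL2 T H) (h : BochnerL2 T H) (f₁ : V) (f₂ : H)
    (u u' : BochnerL2 T V) (u'' : BochnerL2 T (StrongDual ℝ V)) : Prop where
  deriv_u : HasDistribDeriv T u u'
  deriv_u' : HasDistribDeriv T (fun t => toDualOf ι (ι (u' t))) u''
  equation : ∀ v : V, ∀ᵐ t ∂(volume.restrict (Ioo (0 : ℝ) T)),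
    u'' t v + (a₀ t (u t) v + a₁ t (u t) v) + inner ℝ (L (ι.compLp u) t) (ι v)
      = inner ℝ (h t) (ι v)
  init_u : ∃ g : ℝ → V, IsContRepr T g u ∧ g 0 = f₁
  init_u' : ∃ g : ℝ → StrongDual ℝ V,
    IsContRepr T g (fun t => toDualOf ι (ι (u' t))) ∧ g 0 = toDualOf ι f₂

end

/-- `ν = min {1, μ}`. -/
noncomputable def energyNu (μ : ℝ) : ℝ := min 1 μ

/-- `D_T = (C₀ + λ (1 + T)) / ν`. -/
noncomputable def energyD (T lam μ C₀ : ℝ) : ℝ := (C₀ + lam * (1 + T)) / energyNu μ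

/-- `F_T = max {(C₀' + C₁ + C_L²) / ν, (C₁ + 2 + λ (1 + T)) / ν}`. -/
noncomputable def energyF (T lam μ C₀' C₁ CL : ℝ) : ℝ :=
  max ((C₀' + C₁ + CL ^ 2) / energyNu μ) ((C₁ + 2 + lam * (1 + T)) / energyNu μ)

/-!
The proof is the energy method: test the equation with the velocity `u'`, integrate in time, and
apply Gronwall's inequality. Since `u'` takes values in `V` only in the `L²` sense and `u''` only
lies in `V'`, the substance is in the three steps that make this rigorous.

*Primitives.* By the lemma of du Bois-Reymond (`HasDistribDeriv.isContRepr_eq_add_integral`) the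
continuous representatives of `u` in `V` and of `u'` in `V'` are primitives of `u'` and `u''` with
the prescribed initial values. Such primitives are absolutely continuous and almost everywhere
differentiable, so the fundamental theorem of calculus is available for them and for bilinear
expressions in them.

*Continuity of the velocity in `H`* (`exists_continuousOn_eq_and_energy_identity`). The dual `V'`
is identified with `V` by the Riesz isomorphism, under which the embedding `V ⊂ V'` becomes the
positive operator `A = ι† ι`. If `g` is a primitive of `p` and `g = A w` almost everywhere, then
regularising in space by the resolvents `S n = (A + 1 / (n + 1))⁻¹` gives absolutely continuous
curves `S n (g t)` in `V`, with
`‖ι (S n (g t))‖² - ‖ι (S n (g s))‖² = 2 ∫ ⟪(S n A)² w, p⟫` over `[s, t]`.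
As `S n A → 1` strongly with uniformly bounded norms, the same identity for `S m - S n` shows that
the curves `ι (S n (g t))` form a uniform Cauchy sequence in `H`. Their limit is the continuous
representative of `ι w`, and the identity passes to the limit. Regularising in space rather than
in time avoids any extension of the curves beyond `[0, T]`.

*Energy of the form.* The form `a₀` is Lipschitz in time, uniformly on bounded sets, so that
`t ↦ a₀ t (u t) (u t)` is absolutely continuous; difference quotients bound its derivative by
`C₀' ‖u‖² + 2 a₀ t (u t) (u' t)` (`IsAdmissibleForm.ae_deriv_energy_le`).

Adding the two energies, the equation cancels the terms with `u''` and `a₀`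
(`IsAbstractSolution.energy_le`). Coercivity leaves `λ ‖ι (u t)‖²`, which the Cauchy–Schwarz
inequality bounds by `λ (1 + T) (‖f₁‖² + ∫ ‖u'‖²)`, and Gronwall's inequality yields the
estimate with the stated constants (`IsAdmissibleForm.norm_sq_add_norm_sq_le`).
-/

open Filter Topology

/-! ### Absolutely continuous curves -/

theorem AbsolutelyContinuousOnInterval.of_dist_le_add {X Y Z : Type*} [PseudoMetricSpace X]
    [PseudoMetricSpace Y] [PseudoMetricSpace Z] {f : ℝ → X} {g : ℝ → Y} {k : ℝ → Z}
    {a b A B : ℝ} (hg : AbsolutelyContinuousOnInterval g a b)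
    (hk : AbsolutelyContinuousOnInterval k a b)
    (h : ∀ x ∈ uIcc a b, ∀ y ∈ uIcc a b,
      dist (f x) (f y) ≤ A * dist (g x) (g y) + B * dist (k x) (k y)) :
    AbsolutelyContinuousOnInterval f a b := by
  have hlim := (Tendsto.const_mul A hg).add (Tendsto.const_mul B hk)
  simp only [mul_zero, add_zero] at hlim
  refine squeeze_zero' ?_ ?_ hlim
  · exact Eventually.of_forall fun _ => Finset.sum_nonneg fun _ _ => dist_nonneg
  rw [eventually_inf_principal]
  refine Eventually.of_forall fun I hI => ?_
  simp only [Finset.mul_sum, ← Finset.sum_add_distrib]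
  exact Finset.sum_le_sum fun i hi => h _ (hI.1 i hi).1 _ (hI.1 i hi).2

theorem AbsolutelyContinuousOnInterval.of_dist_le {X Y : Type*} [PseudoMetricSpace X]
    [PseudoMetricSpace Y] {f : ℝ → X} {g : ℝ → Y} {a b : ℝ}
    (hg : AbsolutelyContinuousOnInterval g a b)
    (h : ∀ x ∈ uIcc a b, ∀ y ∈ uIcc a b, dist (f x) (f y) ≤ dist (g x) (g y)) :
    AbsolutelyContinuousOnInterval f a b :=
  hg.of_dist_le_add (A := 1) (B := 0) hg fun x hx y hy => by simpa using h x hx y hy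

section AbsolutelyContinuous

variable {E F G : Type*} [NormedAddCommGroup E] [NormedSpace ℝ E]
  [NormedAddCommGroup F] [NormedSpace ℝ F] [NormedAddCommGroup G] [NormedSpace ℝ G]

theorem AbsolutelyContinuousOnInterval.bilinear (B : E →L[ℝ] F →L[ℝ] G) {f : ℝ → E} {g : ℝ → F}
    {a b : ℝ} (hf : AbsolutelyContinuousOnInterval f a b)
    (hg : AbsolutelyContinuousOnInterval g a b) :
    AbsolutelyContinuousOnInterval (fun t => B (f t) (g t)) a b := by
  obtain ⟨C, hC⟩ := hf.exists_bound
  obtain ⟨D, hD⟩ := hg.exists_bound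
  refine hg.of_dist_le_add (A := ‖B‖ * C) (B := ‖B‖ * D) hf fun x hx y hy => ?_
  refine (dist_triangle _ (B (f x) (g y)) _).trans (add_le_add ?_ ?_)
  · rw [dist_eq_norm, dist_eq_norm, ← map_sub]
    refine (B.le_opNorm₂ _ _).trans ?_
    gcongr
    exact hC x hx
  · rw [dist_eq_norm, dist_eq_norm, ← sub_apply, ← map_sub]
    refine (B.le_opNorm₂ _ _).trans ?_
    rw [mul_right_comm]
    gcongr
    exact hD y hy

theorem IntervalIntegrable.absolutelyContinuousOnInterval_integral {f : ℝ → E} {a b : ℝ}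
    (hf : IntervalIntegrable f volume a b) :
    AbsolutelyContinuousOnInterval (fun x => ∫ t in a..x, f t) a b := by
  refine (hf.norm.absolutelyContinuousOnInterval_intervalIntegral
    (c := a) left_mem_uIcc).of_dist_le fun x hx y hy => ?_
  have hsub : ∀ z ∈ uIcc a b, IntervalIntegrable f volume a z := fun z hz =>
    hf.mono_set (uIcc_subset_uIcc left_mem_uIcc hz)
  rw [dist_eq_norm, dist_eq_norm, intervalIntegral.integral_interval_sub_left (hsub x hx)
    (hsub y hy), intervalIntegral.integral_interval_sub_left (hsub x hx).norm (hsub y hy).norm]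
  exact intervalIntegral.norm_integral_le_abs_integral_norm

/-- The fundamental theorem of calculus for a curve in a Banach space that is absolutely
continuous and almost everywhere differentiable; the second property does not follow from the
first in this generality. -/
theorem AbsolutelyContinuousOnInterval.integral_eq_sub_of_ae_hasDerivAt [CompleteSpace E]
    {f f' : ℝ → E} {a b : ℝ} (hf : AbsolutelyContinuousOnInterval f a b)
    (hderiv : ∀ᵐ x, x ∈ uIcc a b → HasDerivAt f (f' x) x)
    (hint : IntervalIntegrable f' volume a b) :
    ∫ t in a..b, f' t = f b - f a := by
  have hac := hf.sub hint.absolutelyContinuousOnInterval_integral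
  obtain ⟨C, hC⟩ := hac.const_of_ae_hasDerivAt_zero (by
    filter_upwards [hderiv, hint.ae_hasDerivAt_integral] with x h1 h2 hx
    have h3 := (h1 hx).sub (h2 hx a left_mem_uIcc)
    rwa [sub_self] at h3)
  have ha := hC a left_mem_uIcc
  have hb := hC b right_mem_uIcc
  simp only [Pi.sub_apply, intervalIntegral.integral_same, sub_zero] at ha hb
  rw [ha, ← hb]
  abel

theorem AbsolutelyContinuousOnInterval.const_add_integral (c : E) {f : ℝ → E} {a b : ℝ}
    (hf : IntervalIntegrable f volume a b) :
    AbsolutelyContinuousOnInterval (fun x => c + ∫ t in a..x, f t) a b :=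
  hf.absolutelyContinuousOnInterval_integral.of_dist_le fun x _ y _ => by simp

theorem IntervalIntegrable.ae_hasDerivAt_const_add_integral [CompleteSpace E] (c : E)
    {f : ℝ → E} {a b : ℝ} (hf : IntervalIntegrable f volume a b) :
    ∀ᵐ x, x ∈ uIcc a b → HasDerivAt (fun x => c + ∫ t in a..x, f t) (f x) x := by
  filter_upwards [hf.ae_hasDerivAt_integral] with x hx hxab
  exact (hx hxab a left_mem_uIcc).const_add c

theorem IntervalIntegrable.bilinear_of_continuousOn (B : E →L[ℝ] F →L[ℝ] G) {f : ℝ → E}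
    {g : ℝ → F} {a b : ℝ} (hf : ContinuousOn f (uIcc a b))
    (hg : IntervalIntegrable g volume a b) :
    IntervalIntegrable (fun t => B (f t) (g t)) volume a b := by
  obtain ⟨C, hC⟩ := isCompact_uIcc.exists_bound_of_continuousOn hf
  rw [intervalIntegrable_iff] at hg ⊢
  have hfm : AEStronglyMeasurable f (volume.restrict (uIoc a b)) :=
    (hf.mono uIoc_subset_uIcc).aestronglyMeasurable measurableSet_uIoc
  refine Integrable.mono' (hg.norm.const_mul (‖B‖ * C))
    (B.aestronglyMeasurable_comp₂ hfm hg.aestronglyMeasurable) ?_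
  refine (ae_restrict_mem measurableSet_uIoc).mono fun t ht => ?_
  refine (B.le_opNorm₂ _ _).trans ?_
  gcongr
  exact hC t (uIoc_subset_uIcc ht)

/-- The derivative of `t ↦ M (g t) (g t)` along a primitive `g` of an integrable function. -/
theorem integral_bilinear_self_eq_sub [CompleteSpace E] (M : E →L[ℝ] E →L[ℝ] ℝ)
    (hM : ∀ x y, M x y = M y x) {p g : ℝ → E} {c : E} {a b s t : ℝ}
    (hp : IntervalIntegrable p volume a b)
    (hg : ∀ t ∈ uIcc a b, g t = c + ∫ r in a..t, p r)
    (hs : s ∈ uIcc a b) (ht : t ∈ uIcc a b) :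
    ∫ r in s..t, 2 * M (g r) (p r) = M (g t) (g t) - M (g s) (g s) := by
  set G : ℝ → E := fun x => c + ∫ r in a..x, p r with hG
  have hst : uIcc s t ⊆ uIcc a b := uIcc_subset_uIcc hs ht
  have hac : AbsolutelyContinuousOnInterval G s t :=
    (AbsolutelyContinuousOnInterval.const_add_integral c hp).mono hst
  have key := (hac.bilinear M hac).integral_eq_sub_of_ae_hasDerivAt
    (f' := fun r => 2 * M (G r) (p r)) (by
      filter_upwards [hp.ae_hasDerivAt_const_add_integral c] with x hx hxst
      have h1 := hx (hst hxst)
      have h2 := M.hasDerivAt_of_bilinear (fun _ => h1) (fun _ => h1)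
      rw [hM (p x), ← two_mul] at h2
      exact h2)
    ((IntervalIntegrable.bilinear_of_continuousOn M hac.continuousOn
      (hp.mono_set hst)).const_mul 2)
  rw [hg t ht, hg s hs]
  refine Eq.trans (intervalIntegral.integral_congr fun r hr => ?_) key
  simp only [hg r (hst hr), hG]

end AbsolutelyContinuous

/-! ### Distributional derivatives of curves on an interval -/

theorem IsContRepr.eq_of_ae_eq {X : Type*} [TopologicalSpace X] [T2Space X] {T : ℝ}
    (hT : 0 < T) {g k u : ℝ → X} (hg : IsContRepr T g u) (hk : IsContRepr T k u) :
    EqOn g k (Icc 0 T) := by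
  refine Measure.eqOn_Icc_of_ae_eq volume hT.ne ?_ hg.1 hk.1
  rw [restrict_Ioo_eq_restrict_Icc.symm]
  filter_upwards [hg.2, hk.2] with t h1 h2
  rw [h1, h2]

section DuBoisReymond

variable {X : Type*} [NormedAddCommGroup X] [NormedSpace ℝ X]

theorem exists_Icc_of_hasCompactSupport {T : ℝ} (hT : 0 < T) {φ : ℝ → ℝ}
    (hc : HasCompactSupport φ) (hs : tsupport φ ⊆ Ioo 0 T) :
    ∃ a b, 0 < a ∧ a ≤ b ∧ b < T ∧ tsupport φ ⊆ Icc a b := by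
  rcases (tsupport φ).eq_empty_or_nonempty with h | h
  · exact ⟨T / 2, T / 2, by linarith, le_rfl, by linarith, by simp [h]⟩
  · have hK : IsCompact (tsupport φ) := hc
    exact ⟨sInf (tsupport φ), sSup (tsupport φ), (hs (hK.sInf_mem h)).1,
      csInf_le hK.bddBelow (hK.sSup_mem h), (hs (hK.sSup_mem h)).2,
      fun x hx => ⟨csInf_le hK.bddBelow hx, le_csSup hK.bddAbove hx⟩⟩

/-- A test function with vanishing integral is the derivative of a test function. -/
theorem exists_primitive_testFunction {T : ℝ} (hT : 0 < T) {ψ : ℝ → ℝ} (hψ : ContDiff ℝ ∞ ψ)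
    (hc : HasCompactSupport ψ) (hs : tsupport ψ ⊆ Ioo 0 T) (h0 : ∫ t in 0..T, ψ t = 0) :
    ∃ φ : ℝ → ℝ, ContDiff ℝ ∞ φ ∧ HasCompactSupport φ ∧ tsupport φ ⊆ Ioo 0 T ∧ deriv φ = ψ := by
  obtain ⟨a, b, ha, hab, hb, hsub⟩ := exists_Icc_of_hasCompactSupport hT hc hs
  have hzero : ∀ x, x ∉ Icc a b → ψ x = 0 := fun x hx =>
    image_eq_zero_of_notMem_tsupport fun h => hx (hsub h)
  have hint : ∀ x y, IntervalIntegrable ψ volume x y := fun x y =>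
    hψ.continuous.intervalIntegrable _ _
  have hder : ∀ x, HasDerivAt (fun x => ∫ t in 0..x, ψ t) (ψ x) x := fun x =>
    intervalIntegral.integral_hasDerivAt_right (hint _ _)
      (hψ.continuous.stronglyMeasurableAtFilter _ _) hψ.continuous.continuousAt
  have hd : deriv (fun x => ∫ t in 0..x, ψ t) = ψ := funext fun x => (hder x).deriv
  have hsupp : Function.support (fun x => ∫ t in 0..x, ψ t) ⊆ Icc a b := by
    intro x hx
    by_contra hxab
    refine hx ?_
    rcases lt_or_ge x a with hxa | hxa
    · refine (intervalIntegral.integral_congr fun y hy => ?_).trans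
        (intervalIntegral.integral_zero (a := 0) (b := x))
      exact hzero y fun h => absurd (hy.2.trans_lt (max_lt ha hxa)) h.1.not_gt
    · have hbx : b < x := not_le.mp fun h => hxab ⟨hxa, h⟩
      have h1 : ∫ t in T..x, ψ t = 0 := by
        refine (intervalIntegral.integral_congr fun y hy => ?_).trans
          (intervalIntegral.integral_zero (a := T) (b := x))
        exact hzero y fun h => absurd ((lt_min hb hbx).trans_le hy.1) h.2.not_gt
      change ∫ t in 0..x, ψ t = 0
      rw [← intervalIntegral.integral_add_adjacent_intervals (hint 0 T) (hint T x), h0, h1,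
        add_zero]
  refine ⟨fun x => ∫ t in 0..x, ψ t, ?_, HasCompactSupport.of_support_subset_isCompact
    isCompact_Icc hsupp, (closure_minimal hsupp isClosed_Icc).trans
      fun x hx => ⟨ha.trans_le hx.1, hx.2.trans_lt hb⟩, hd⟩
  rw [contDiff_infty_iff_deriv, hd]
  exact ⟨fun x => (hder x).differentiableAt, hψ⟩

theorem exists_testFunction_integral_eq_one {T : ℝ} (hT : 0 < T) :
    ∃ ψ : ℝ → ℝ, ContDiff ℝ ∞ ψ ∧ HasCompactSupport ψ ∧ tsupport ψ ⊆ Ioo 0 T ∧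
      ∫ t in 0..T, ψ t = 1 := by
  let f : ContDiffBump (T / 2) := ⟨T / 8, T / 4, by positivity, by linarith⟩
  have hsub : tsupport (f.normed volume) ⊆ Ioo 0 T := by
    rw [f.tsupport_normed_eq, Real.closedBall_eq_Icc]
    intro x hx
    have h1 : T / 2 - T / 4 ≤ x := hx.1
    have h2 : x ≤ T / 2 + T / 4 := hx.2
    exact ⟨by linarith, by linarith⟩
  refine ⟨f.normed volume, f.contDiff_normed, f.hasCompactSupport_normed, hsub, ?_⟩
  rw [intervalIntegral.integral_of_le hT.le, setIntegral_eq_integral_of_forall_compl_eq_zero,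
    f.integral_normed]
  intro x hx
  exact image_eq_zero_of_notMem_tsupport fun h => hx (Ioo_subset_Ioc_self (hsub h))

/-- The lemma of du Bois-Reymond: a function with an integrable distributional derivative `w` is
almost everywhere a primitive of `w`. -/
theorem HasDistribDeriv.exists_ae_eq_add_integral [CompleteSpace X] {T : ℝ} (hT : 0 < T)
    {u w : ℝ → X} (hu : IntervalIntegrable u volume 0 T) (hw : IntervalIntegrable w volume 0 T)
    (h : HasDistribDeriv T u w) :
    ∃ c : X, ∀ᵐ t ∂(volume.restrict (Ioo (0 : ℝ) T)), u t = c + ∫ s in 0..t, w s := by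
  have conv : ∀ f : ℝ → X, ∫ t in Ioo 0 T, f t = ∫ t in 0..T, f t := fun f => by
    rw [intervalIntegral.integral_of_le hT.le, integral_Ioc_eq_integral_Ioo]
  set v : ℝ → X := fun t => ∫ s in 0..t, w s with hv
  have hvac : AbsolutelyContinuousOnInterval v 0 T := hw.absolutelyContinuousOnInterval_integral
  have hvint : IntervalIntegrable v volume 0 T := hvac.continuousOn.intervalIntegrable
  have smulint : ∀ (φ : ℝ → ℝ) (f : ℝ → X), Continuous φ → IntervalIntegrable f volume 0 T →
      IntervalIntegrable (fun t => φ t • f t) volume 0 T := fun φ f hφ hf =>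
    hf.continuousOn_smul hφ.continuousOn
  -- The distributional derivative of `u - v` vanishes.
  have hdist : ∀ φ : ℝ → ℝ, ContDiff ℝ ∞ φ → HasCompactSupport φ → tsupport φ ⊆ Ioo 0 T →
      ∫ t in 0..T, deriv φ t • (u t - v t) = 0 := by
    intro φ hφ hc hs
    have hd : Continuous (deriv φ) := hφ.continuous_deriv (by simp)
    have hφac : AbsolutelyContinuousOnInterval φ 0 T :=
      (hφ.of_le (by simp)).contDiffOn.absolutelyContinuousOnInterval
    have hparts := (hφac.fun_smul hvac).integral_eq_sub_of_ae_hasDerivAt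
      (f' := fun t => φ t • w t + deriv φ t • v t) (by
        filter_upwards [hw.ae_hasDerivAt_integral] with x hx hxT
        exact ((hφ.differentiable (by simp)).differentiableAt.hasDerivAt).fun_smul
          (hx hxT 0 left_mem_uIcc))
      ((smulint φ w hφ.continuous hw).add (smulint _ v hd hvint))
    have hφT : φ T = 0 := image_eq_zero_of_notMem_tsupport fun h => lt_irrefl _ (hs h).2
    rw [intervalIntegral.integral_add (smulint φ w hφ.continuous hw) (smulint _ v hd hvint)]
      at hparts
    simp only [hφT, hv, intervalIntegral.integral_same, zero_smul, smul_zero, sub_zero] at hparts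
    have hdef := h φ hφ hc hs
    rw [conv, conv] at hdef
    simp only [smul_sub]
    rw [intervalIntegral.integral_sub (smulint _ u hd hu) (smulint _ v hd hvint), hdef,
      ← neg_add', neg_eq_zero]
    exact hparts
  obtain ⟨ψ₀, hψ₀, hc₀, hs₀, h1⟩ := exists_testFunction_integral_eq_one hT
  set c : X := ∫ t in 0..T, ψ₀ t • (u t - v t) with hcdef
  refine ⟨c, ?_⟩
  have hduv : IntervalIntegrable (fun t => u t - v t) volume 0 T := hu.sub hvint
  have hfin : IntervalIntegrable (fun t => u t - v t - c) volume 0 T :=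
    hduv.sub intervalIntegrable_const
  have hloc : IntegrableOn (fun t => u t - v t - c) (Ioo 0 T) volume := by
    rwa [← intervalIntegrable_iff_integrableOn_Ioo_of_le hT.le]
  have hae := isOpen_Ioo.ae_eq_zero_of_integral_contDiff_smul_eq_zero hloc.locallyIntegrableOn
    (fun ψ hψ hc hs => by
      have hsub : ∫ t, ψ t • (u t - v t - c) = ∫ t in 0..T, ψ t • (u t - v t - c) := by
        rw [← conv, setIntegral_eq_integral_of_forall_compl_eq_zero]
        intro x hx
        rw [image_eq_zero_of_notMem_tsupport fun h => hx (hs h), zero_smul]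
      rw [hsub]
      set m : ℝ := ∫ t in 0..T, ψ t with hm
      -- Subtracting `m • ψ₀` makes the integral of `ψ` vanish.
      have hdiff : ContDiff ℝ ∞ (fun t => ψ t - m * ψ₀ t) := hψ.sub (contDiff_const.mul hψ₀)
      have hss : Function.support (fun t => ψ t - m * ψ₀ t) ⊆ tsupport ψ ∪ tsupport ψ₀ := by
        intro x hx
        by_contra hxn
        rw [mem_union, not_or] at hxn
        exact hx (by simp [image_eq_zero_of_notMem_tsupport hxn.1,
          image_eq_zero_of_notMem_tsupport hxn.2])
      have hcpt : IsCompact (tsupport ψ ∪ tsupport ψ₀) := IsCompact.union hc hc₀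
      obtain ⟨φ, hφ, hφc, hφs, hφd⟩ := exists_primitive_testFunction hT hdiff
        (HasCompactSupport.of_support_subset_isCompact hcpt hss)
        ((closure_minimal hss hcpt.isClosed).trans (union_subset hs hs₀)) (by
          have h2 : IntervalIntegrable (fun t => m * ψ₀ t) volume 0 T :=
            (continuous_const.mul hψ₀.continuous).intervalIntegrable _ _
          rw [intervalIntegral.integral_sub (hψ.continuous.intervalIntegrable _ _) h2,
            intervalIntegral.integral_const_mul, h1, ← hm, mul_one, sub_self])
      have hz := hdist φ hφ hφc hφs
      rw [hφd] at hz
      simp only [sub_smul, mul_smul] at hz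
      have h3 : IntervalIntegrable (fun t => m • ψ₀ t • (u t - v t)) volume 0 T :=
        (smulint ψ₀ _ hψ₀.continuous hduv).smul m
      rw [intervalIntegral.integral_sub (smulint ψ _ hψ.continuous hduv) h3, intervalIntegral.integral_smul, ← hcdef,
        sub_eq_zero] at hz
      simp only [smul_sub _ _ c]
      rw [intervalIntegral.integral_sub (smulint ψ _ hψ.continuous hduv)
        (smulint ψ _ hψ.continuous intervalIntegrable_const), hz,
        intervalIntegral.integral_smul_const, sub_self])
  rw [ae_restrict_iff' measurableSet_Ioo]
  filter_upwards [hae] with t ht htT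
  have h2 := ht htT
  rw [sub_sub, sub_eq_zero] at h2
  rw [h2, add_comm]

/-- The continuous representative is the primitive of the distributional derivative that starts
from its value at `0`. -/
theorem HasDistribDeriv.isContRepr_eq_add_integral [CompleteSpace X] {T : ℝ} (hT : 0 < T)
    {u w g : ℝ → X} (hu : IntervalIntegrable u volume 0 T)
    (hw : IntervalIntegrable w volume 0 T) (h : HasDistribDeriv T u w) (hg : IsContRepr T g u) :
    ∀ t ∈ Icc 0 T, g t = g 0 + ∫ s in 0..t, w s := by
  obtain ⟨c, hc⟩ := h.exists_ae_eq_add_integral hT hu hw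
  have hcont : ContinuousOn (fun t => c + ∫ s in 0..t, w s) (Icc 0 T) := by
    have := (AbsolutelyContinuousOnInterval.const_add_integral c hw).continuousOn
    rwa [uIcc_of_le hT.le] at this
  have heq := hg.eq_of_ae_eq hT ⟨hcont, hc.mono fun t ht => ht.symm⟩
  have h0 : g 0 = c := by simpa using heq (left_mem_Icc.mpr hT.le)
  intro t ht
  rw [h0]
  exact heq ht

end DuBoisReymond

/-! ### Resolvents of a positive operator -/

section Resolvent

variable {V : Type*} [NormedAddCommGroup V] [InnerProductSpace ℝ V] [CompleteSpace V]

/-- The resolvents `S n = (A + 1 / (n + 1))⁻¹` of a positive symmetric operator `A` with dense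
range commute with `A`, and `S n ∘ A` tends strongly to the identity. -/
theorem exists_strong_approx_inverse (A : V →L[ℝ] V)
    (hsymm : ∀ x y, inner ℝ (A x) y = inner ℝ x (A y)) (hpos : ∀ x, 0 ≤ inner ℝ (A x) x)
    (hdense : DenseRange A) :
    ∃ S : ℕ → V →L[ℝ] V, (∀ n x, S n (A x) = A (S n x)) ∧
      (∀ n x y, inner ℝ (S n x) y = inner ℝ x (S n y)) ∧
      (∀ n x, ‖x - S n (A x)‖ ≤ ‖x‖) ∧
      ∀ x, Tendsto (fun n => S n (A x)) atTop (𝓝 x) := by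
  set ε : ℕ → ℝ := fun n => 1 / ((n : ℝ) + 1) with hε
  have hεpos : ∀ n, 0 < ε n := fun n => by positivity
  set B : ℕ → V →L[ℝ] V := fun n => A + ε n • ContinuousLinearMap.id ℝ V with hB
  have hBx : ∀ n x, B n x = A x + ε n • x := fun n x => by simp [hB]
  have hcoer : ∀ n x, ε n * ‖x‖ ^ 2 ≤ inner ℝ (B n x) x := fun n x => by
    rw [hBx, inner_add_left, inner_smul_left, real_inner_self_eq_norm_sq]
    simpa using hpos x
  have hunit : ∀ n, IsUnit (B n) := fun n =>
    ContinuousLinearMap.isUnit_of_forall_le_norm_inner_map (B n) (c := ⟨ε n, (hεpos n).le⟩)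
      (hεpos n) fun x => by
        rw [mul_comm]
        exact (hcoer n x).trans (le_abs_self _)
  choose U hU using hunit
  set S : ℕ → V →L[ℝ] V := fun n => ((U n)⁻¹ : (V →L[ℝ] V)ˣ) with hS
  have hBS : ∀ n x, B n (S n x) = x := fun n x => by
    have h1 : B n * S n = 1 := by rw [← hU]; exact (U n).mul_inv
    exact DFunLike.congr_fun h1 x
  have hSB : ∀ n x, S n (B n x) = x := fun n x => by
    have h1 : S n * B n = 1 := by rw [← hU]; exact (U n).inv_mul
    exact DFunLike.congr_fun h1 x
  have hcomm : ∀ n x, S n (A x) = A (S n x) := fun n x => by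
    have h1 : A x = B n (A (S n x)) := by
      conv_lhs => rw [← hBS n x, hBx]
      rw [hBx, map_add, map_smul]
    rw [h1, hSB]
  have hBsymm : ∀ n x y, inner ℝ (B n x) y = inner ℝ x (B n y) := fun n x y => by
    simp only [hBx, inner_add_left, inner_add_right, inner_smul_left, inner_smul_right, hsymm]
    simp
  have hres : ∀ n x, x - S n (A x) = ε n • S n x := fun n x => by
    conv_lhs => rw [← hSB n x]
    rw [← map_sub, hSB, hBx, add_sub_cancel_left, map_smul]
  have hbound : ∀ n x, ‖x - S n (A x)‖ ≤ ‖x‖ := fun n x => by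
    rw [hres, norm_smul, Real.norm_of_nonneg (hεpos n).le]
    rcases (norm_nonneg (S n x)).eq_or_lt with h0 | h0
    · rw [← h0, mul_zero]
      exact norm_nonneg x
    · have h1 := hcoer n (S n x)
      rw [hBS] at h1
      have h2 := h1.trans (real_inner_le_norm _ _)
      rw [pow_two, ← mul_assoc] at h2
      exact le_of_mul_le_mul_right h2 h0
  refine ⟨S, hcomm, fun n x y => ?_, hbound, fun x => ?_⟩
  · conv_lhs => rw [← hBS n y]
    rw [← hBsymm, hBS]
  · rw [Metric.tendsto_atTop]
    intro η hη
    obtain ⟨y, hy⟩ := hdense.exists_dist_lt x (half_pos hη)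
    have hlim : Tendsto (fun n => ε n * (2 * ‖y‖)) atTop (𝓝 0) := by
      have := (tendsto_one_div_add_atTop_nhds_zero_nat (𝕜 := ℝ)).mul_const (2 * ‖y‖)
      rwa [zero_mul] at this
    obtain ⟨N, hN⟩ := (hlim.eventually_lt_const (half_pos hη)).exists_forall_of_atTop
    refine ⟨N, fun n hn => ?_⟩
    have h1 : x - S n (A x) = ((x - A y) - S n (A (x - A y))) + ε n • S n (A y) := by
      rw [← hres, map_sub, map_sub]
      abel
    have h2 : ‖S n (A y)‖ ≤ 2 * ‖y‖ := by
      calc ‖S n (A y)‖ = ‖y - (y - S n (A y))‖ := by rw [sub_sub_cancel]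
        _ ≤ ‖y‖ + ‖y - S n (A y)‖ := norm_sub_le _ _
        _ ≤ 2 * ‖y‖ := by linarith [hbound n y]
    rw [dist_comm, dist_eq_norm, h1]
    calc _ ≤ ‖x - A y - S n (A (x - A y))‖ + ‖ε n • S n (A y)‖ := norm_add_le _ _
      _ ≤ ‖x - A y‖ + ε n * (2 * ‖y‖) := by
        rw [norm_smul, Real.norm_of_nonneg (hεpos n).le]
        exact add_le_add (hbound n _) (mul_le_mul_of_nonneg_left h2 (hεpos n).le)
      _ < η / 2 + η / 2 := by
        rw [← dist_eq_norm]
        exact add_lt_add hy (hN n hn)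
      _ = η := add_halves η

end Resolvent

/-! ### Continuity in the pivot space -/

section LionsMagenes

variable {V H : Type*} [NormedAddCommGroup V] [InnerProductSpace ℝ V] [CompleteSpace V]
  [NormedAddCommGroup H] [InnerProductSpace ℝ H] [CompleteSpace H]

/-- The operator `ι† ι` on `V`. Under the Riesz identification of `V` with its dual it is the
embedding of `V` into `V'` through the pivot space `H`. -/
noncomputable def gramOperator (ι : V →L[ℝ] H) : V →L[ℝ] V :=
  (ContinuousLinearMap.adjoint ι).comp ι

theorem inner_gramOperator_left (ι : V →L[ℝ] H) (x y : V) :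
    inner ℝ (gramOperator ι x) y = inner ℝ (ι x) (ι y) :=
  ContinuousLinearMap.adjoint_inner_left ι y (ι x)

theorem inner_gramOperator_right (ι : V →L[ℝ] H) (x y : V) :
    inner ℝ x (gramOperator ι y) = inner ℝ (ι x) (ι y) :=
  ContinuousLinearMap.adjoint_inner_right ι x (ι y)

theorem denseRange_gramOperator {ι : V →L[ℝ] H} (hι : Function.Injective ι) :
    DenseRange (gramOperator ι) := by
  change Dense (Set.range (gramOperator ι))
  have h : Dense ((gramOperator ι).range : Set V) := by
    rw [Submodule.dense_iff_topologicalClosure_eq_top, Submodule.topologicalClosure_eq_top_iff,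
      Submodule.eq_bot_iff]
    intro x hx
    have h1 : inner ℝ (gramOperator ι x) x = 0 := hx _ ⟨x, rfl⟩
    rw [inner_gramOperator_left, inner_self_eq_zero] at h1
    exact hι (h1.trans (map_zero ι).symm)
  rwa [LinearMap.coe_range] at h

/-- The energy identity for the curve `ι ∘ D ∘ g`, where `D` is symmetric and `g`, a primitive
of `p`, equals `ι† ι w` almost everywhere. -/
theorem norm_sq_sub_norm_sq_eq_integral (ι : V →L[ℝ] H) (D : V →L[ℝ] V)
    (hsymm : ∀ x y, inner ℝ (D x) y = inner ℝ x (D y)) {T : ℝ} {w p g : ℝ → V}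
    (hp : IntervalIntegrable p volume 0 T)
    (hg : ∀ t ∈ uIcc 0 T, g t = g 0 + ∫ r in 0..t, p r)
    (hgw : ∀ᵐ t, t ∈ uIcc 0 T → g t = gramOperator ι (w t)) {s t : ℝ}
    (hs : s ∈ uIcc 0 T) (ht : t ∈ uIcc 0 T) :
    ‖ι (D (g t))‖ ^ 2 - ‖ι (D (g s))‖ ^ 2 =
      ∫ r in s..t, 2 * inner ℝ (D (gramOperator ι (D (gramOperator ι (w r))))) (p r) := by
  have h := integral_bilinear_self_eq_sub
    ((innerSL ℝ (E := H)).bilinearComp (ι.comp D) (ι.comp D))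
    (fun x y => real_inner_comm _ _) hp hg hs ht
  simp only [ContinuousLinearMap.bilinearComp_apply, ContinuousLinearMap.comp_apply,
    innerSL_apply_apply, real_inner_self_eq_norm_sq] at h
  rw [← h]
  refine intervalIntegral.integral_congr_ae ?_
  filter_upwards [hgw] with r hr hrst
  rw [hr (uIcc_subset_uIcc hs ht (uIoc_subset_uIcc hrst)), ← inner_gramOperator_left, ← hsymm]

/-- Let `w` and `p` be curves in `V` whose product of norms is integrable, and let `g`, a
primitive of `p`, equal `ι† ι w` almost everywhere; that is, `p` represents the derivative of `w`
in the dual of `V`. Then `ι w` has a representative that is continuous in `H`, and its squared norm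
is a primitive of `2 ⟪w, p⟫`.

The proof regularises in space: the curves `ι (S n (g t))`, with `S n` the resolvents of `ι† ι`,
are absolutely continuous and form a uniform Cauchy sequence in `H`. -/
theorem exists_continuousOn_eq_and_energy_identity {ι : V →L[ℝ] H} (hι : Function.Injective ι)
    {T : ℝ} (hT : 0 < T) {w p g : ℝ → V}
    (hw : AEStronglyMeasurable w (volume.restrict (uIoc 0 T)))
    (hp : IntervalIntegrable p volume 0 T)
    (hwp : IntervalIntegrable (fun t => ‖w t‖ * ‖p t‖) volume 0 T)
    (hg : ∀ t ∈ uIcc 0 T, g t = g 0 + ∫ r in 0..t, p r)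
    (hgw : ∀ᵐ t, t ∈ uIcc 0 T → g t = gramOperator ι (w t)) :
    ∃ W : ℝ → H, ContinuousOn W (uIcc 0 T) ∧ (∀ᵐ t, t ∈ uIcc 0 T → W t = ι (w t)) ∧
      (∀ t ∈ uIcc 0 T, ContinuousLinearMap.adjoint ι (W t) = g t) ∧
      ∀ t ∈ uIcc 0 T, ‖W t‖ ^ 2 - ‖W 0‖ ^ 2 = ∫ r in 0..t, 2 * inner ℝ (w r) (p r) := by
  set A := gramOperator ι with hA
  obtain ⟨S, hcomm, hsymm, hbound, hlim⟩ := exists_strong_approx_inverse A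
    (fun x y => by rw [inner_gramOperator_left, inner_gramOperator_right])
    (fun x => by rw [inner_gramOperator_left]; exact real_inner_self_nonneg)
    (denseRange_gramOperator hι)
  have hpm := (intervalIntegrable_iff.mp hp).aestronglyMeasurable
  have hsa : ∀ n x, ‖S n (A x)‖ ≤ 2 * ‖x‖ := fun n x => by
    calc ‖S n (A x)‖ = ‖x - (x - S n (A x))‖ := by rw [sub_sub_cancel]
      _ ≤ ‖x‖ + ‖x - S n (A x)‖ := norm_sub_le _ _
      _ ≤ 2 * ‖x‖ := by linarith [hbound n x]
  have hg_cont : ContinuousOn g (uIcc 0 T) :=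
    (AbsolutelyContinuousOnInterval.const_add_integral (g 0) hp).continuousOn.congr hg
  -- The regularisation error, in the norm that the energy identity controls.
  set q : ℕ → ℝ → ℝ := fun n r => ‖w r - S n (A (w r))‖ * ‖p r‖ with hq
  have hqm : ∀ n, AEStronglyMeasurable (q n) (volume.restrict (uIoc 0 T)) := fun n =>
    (hw.sub ((S n).continuous.comp_aestronglyMeasurable
      (A.continuous.comp_aestronglyMeasurable hw))).norm.mul hpm.norm
  have hq_le : ∀ n r, ‖q n r‖ ≤ ‖w r‖ * ‖p r‖ := fun n r => by
    rw [Real.norm_of_nonneg (by positivity)]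
    exact mul_le_mul_of_nonneg_right (hbound n _) (norm_nonneg _)
  have hq_int : ∀ n, IntervalIntegrable (q n) volume 0 T := fun n =>
    hwp.mono_fun (hqm n) (Eventually.of_forall fun r =>
      (hq_le n r).trans (le_abs_self _))
  set δ : ℕ → ℝ := fun n => ∫ r in 0..T, q n r with hδ
  have hδ_lim : Tendsto δ atTop (𝓝 0) := by
    have h := intervalIntegral.tendsto_integral_filter_of_dominated_convergence
      (μ := volume) (a := 0) (b := T) (F := q) (f := fun _ => (0 : ℝ)) (l := atTop)
      (fun r => ‖w r‖ * ‖p r‖) (Eventually.of_forall hqm)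
      (Eventually.of_forall fun n => Eventually.of_forall fun r _ => hq_le n r) hwp
      (Eventually.of_forall fun r _ => by
        have h1 := ((tendsto_const_nhds (x := w r)).sub (hlim (w r))).norm.mul_const ‖p r‖
        simpa using h1)
    simpa using h
  set F : ℕ → ℝ → H := fun n t => ι (S n (g t)) with hF
  have hF_cont : ∀ n, ContinuousOn (F n) (uIcc 0 T) := fun n =>
    (ι.comp (S n)).continuous.comp_continuousOn hg_cont
  have hdiff : ∀ m n, ∀ s ∈ uIcc 0 T, ∀ t ∈ uIcc 0 T,
      ‖F m t - F n t‖ ^ 2 ≤ ‖F m s - F n s‖ ^ 2 + 4 * (δ m + δ n) := by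
    intro m n s hs t ht
    have h := norm_sq_sub_norm_sq_eq_integral ι (S m - S n)
      (fun x y => by simp only [sub_apply, inner_sub_left, inner_sub_right, hsymm])
      hp hg hgw hs ht
    rw [← hA] at h
    have hEx : ∀ x, ‖(S m - S n) (A x)‖ ≤ ‖x - S m (A x)‖ + ‖x - S n (A x)‖ := fun x => by
      rw [sub_apply, ← sub_sub_sub_cancel_left _ _ x, add_comm]
      exact norm_sub_le _ _
    have hint : IntervalIntegrable (fun r => 4 * (q m r + q n r)) volume 0 T :=
      ((hq_int m).add (hq_int n)).const_mul 4
    have hsub : uIcc s t ⊆ uIcc 0 T := uIcc_subset_uIcc hs ht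
    have h1 : |∫ r in s..t, 2 * inner ℝ ((S m - S n) (A ((S m - S n) (A (w r))))) (p r)| ≤
        |∫ r in s..t, 4 * (q m r + q n r)| := by
      rw [← Real.norm_eq_abs]
      refine intervalIntegral.norm_integral_le_abs_of_norm_le
        (Eventually.of_forall fun r => ?_) (hint.mono_set hsub)
      have h2 := hEx ((S m - S n) (A (w r)))
      have h3 := hbound m ((S m - S n) (A (w r)))
      have h4 := hbound n ((S m - S n) (A (w r)))
      have h5 := hEx (w r)
      have h6 := (abs_real_inner_le_norm ((S m - S n) (A ((S m - S n) (A (w r))))) (p r)).trans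
        (mul_le_mul_of_nonneg_right (h2.trans (by linarith :
          _ ≤ 2 * (‖w r - S m (A (w r))‖ + ‖w r - S n (A (w r))‖))) (norm_nonneg (p r)))
      rw [norm_mul, Real.norm_ofNat, Real.norm_eq_abs]
      calc _ ≤ 2 * _ := mul_le_mul_of_nonneg_left h6 zero_le_two
        _ = 4 * (q m r + q n r) := by simp only [hq]; ring
    have h2 : |∫ r in s..t, 4 * (q m r + q n r)| ≤ 4 * (δ m + δ n) := by
      have h3 := intervalIntegral.abs_integral_mono_interval
        (uIoc_subset_uIoc_of_uIcc_subset_uIcc hsub)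
        (Eventually.of_forall fun r => by simp only [hq, Pi.zero_apply]; positivity) hint
      have h4 : ∫ r in 0..T, 4 * (q m r + q n r) = 4 * (δ m + δ n) := by
        rw [intervalIntegral.integral_const_mul,
          intervalIntegral.integral_add (hq_int m) (hq_int n)]
      rw [h4] at h3
      refine h3.trans_eq (abs_of_nonneg ?_)
      rw [← h4]
      exact intervalIntegral.integral_nonneg hT.le fun r _ => by simp only [hq]; positivity
    have h3 := (le_abs_self _).trans (h1.trans h2)
    rw [← h] at h3
    simp only [sub_apply, map_sub] at h3
    linarith
  -- A point at which the regularised curves converge.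
  obtain ⟨s, hs, hgs⟩ : ∃ s ∈ uIcc 0 T, g s = A (w s) := by
    have hne : (ae (volume.restrict (Ioc 0 T))).NeBot := by
      rw [ae_neBot, Ne, Measure.restrict_eq_zero]
      simp [hT]
    obtain ⟨s, h1, h2⟩ := ((ae_restrict_of_ae hgw).and
      (ae_restrict_mem (measurableSet_Ioc (a := (0 : ℝ)) (b := T)))).exists
    have h3 : s ∈ uIcc 0 T := by
      rw [uIcc_of_le hT.le]
      exact Ioc_subset_Icc_self h2
    exact ⟨s, h3, h1 h3⟩
  have hFs : CauchySeq fun n => F n s := by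
    refine Tendsto.cauchySeq (x := ι (w s)) ?_
    simp only [hF, hgs]
    exact (ι.continuous.tendsto _).comp (hlim (w s))
  have hcauchy : UniformCauchySeqOn F atTop (uIcc 0 T) := by
    rw [Metric.uniformCauchySeqOn_iff]
    intro η hη
    obtain ⟨N₁, hN₁⟩ := Metric.cauchySeq_iff.mp hFs (η / 2) (half_pos hη)
    obtain ⟨N₂, hN₂⟩ := (hδ_lim.eventually_lt_const
      (by positivity : (0 : ℝ) < η ^ 2 / 16)).exists_forall_of_atTop
    refine ⟨max N₁ N₂, fun m hm n hn t ht => ?_⟩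
    have h1 := hN₁ m (le_of_max_le_left hm) n (le_of_max_le_left hn)
    have h2 := hN₂ m (le_of_max_le_right hm)
    have h3 := hN₂ n (le_of_max_le_right hn)
    have h4 := hdiff m n s hs t ht
    rw [← dist_eq_norm, ← dist_eq_norm] at h4
    have h5 : dist (F m s) (F n s) ^ 2 < (η / 2) ^ 2 := by gcongr
    refine lt_of_pow_lt_pow_left₀ 2 hη.le ?_
    nlinarith [sq_nonneg η]
  have hpt : ∀ t, ∃ y, t ∈ uIcc 0 T → Tendsto (fun n => F n t) atTop (𝓝 y) := fun t => by
    by_cases ht : t ∈ uIcc 0 T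
    · obtain ⟨y, hy⟩ := cauchySeq_tendsto_of_complete (hcauchy.cauchySeq ht)
      exact ⟨y, fun _ => hy⟩
    · exact ⟨0, fun h => absurd h ht⟩
  choose W hW using hpt
  have hunif : TendstoUniformlyOn F W atTop (uIcc 0 T) :=
    hcauchy.tendstoUniformlyOn_of_tendsto fun t ht => hW t ht
  have h0 : (0 : ℝ) ∈ uIcc 0 T := left_mem_uIcc
  refine ⟨W, hunif.continuousOn (Frequently.of_forall hF_cont), ?_, fun t ht => ?_,
    fun t ht => ?_⟩
  · filter_upwards [hgw] with t h1 ht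
    refine tendsto_nhds_unique (hW t ht) ?_
    simp only [hF, h1 ht]
    exact (ι.continuous.tendsto _).comp (hlim (w t))
  · have h1 := ((ContinuousLinearMap.adjoint ι).continuous.tendsto _).comp (hW t ht)
    refine tendsto_nhds_unique h1 ?_
    refine (hlim (g t)).congr fun n => ?_
    rw [hcomm]
    rfl
  · have h1 : Tendsto (fun n => ‖F n t‖ ^ 2 - ‖F n 0‖ ^ 2) atTop
        (𝓝 (‖W t‖ ^ 2 - ‖W 0‖ ^ 2)) := ((hW t ht).norm.pow 2).sub ((hW 0 h0).norm.pow 2)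
    refine tendsto_nhds_unique h1 ?_
    have hsub : uIoc 0 t ⊆ uIoc 0 T :=
      uIoc_subset_uIoc_of_uIcc_subset_uIcc (uIcc_subset_uIcc h0 ht)
    have h2 := intervalIntegral.tendsto_integral_filter_of_dominated_convergence
      (μ := volume) (a := 0) (b := t) (l := atTop)
      (F := fun n r => 2 * inner ℝ (S n (A (S n (A (w r))))) (p r))
      (f := fun r => 2 * inner ℝ (w r) (p r))
      (fun r => 8 * (‖w r‖ * ‖p r‖))
      (Eventually.of_forall fun n => by
        have hm : AEStronglyMeasurable (fun r => S n (A (S n (A (w r)))))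
            (volume.restrict (uIoc 0 T)) :=
          ((S n).comp (A.comp ((S n).comp A))).continuous.comp_aestronglyMeasurable hw
        exact ((hm.inner hpm).const_mul 2).mono_measure (Measure.restrict_mono hsub le_rfl))
      (Eventually.of_forall fun n => Eventually.of_forall fun r _ => by
        rw [norm_mul, Real.norm_ofNat]
        have h3 := norm_inner_le_norm (𝕜 := ℝ) (S n (A (S n (A (w r))))) (p r)
        have h4 := mul_le_mul_of_nonneg_right ((hsa n (S n (A (w r)))).trans
          (mul_le_mul_of_nonneg_left (hsa n (w r)) zero_le_two)) (norm_nonneg (p r))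
        linarith)
      ((hwp.const_mul 8).mono_set (uIcc_subset_uIcc h0 ht))
      (Eventually.of_forall fun r _ => by
        have h3 : Tendsto (fun n => S n (A (S n (A (w r))))) atTop (𝓝 (w r)) := by
          have h4 : Tendsto (fun n => S n (A (S n (A (w r)) - w r)) + S n (A (w r))) atTop
              (𝓝 (0 + w r)) := by
            refine Tendsto.add ?_ (hlim (w r))
            refine squeeze_zero_norm (fun n => hsa n _) ?_
            have h5 := (((hlim (w r)).sub_const (w r)).norm).const_mul 2
            simpa using h5
          rw [zero_add] at h4
          refine h4.congr fun n => ?_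
          rw [map_sub, map_sub, sub_add_cancel]
        exact (h3.inner tendsto_const_nhds).const_mul 2)
    refine h2.congr fun n => ?_
    exact (norm_sq_sub_norm_sq_eq_integral ι (S n) (hsymm n) hp hg hgw h0 ht).symm

end LionsMagenes

/-! ### Integral inequalities -/

section IntegralInequalities

/-- Gronwall's inequality in integral form. -/
theorem le_mul_exp_of_le_add_mul_integral {φ : ℝ → ℝ} {α F t : ℝ} (ht : 0 ≤ t) (hF : 0 ≤ F)
    (hφ : ContinuousOn φ (Icc 0 t)) (h : ∀ s ∈ Icc 0 t, φ s ≤ α + F * ∫ r in 0..s, φ r) :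
    φ t ≤ α * Real.exp (t * F) := by
  set y : ℝ → ℝ := fun s => α + F * ∫ r in 0..s, φ r with hy
  have hint : IntervalIntegrable φ volume 0 t := by
    refine ContinuousOn.intervalIntegrable ?_
    rwa [uIcc_of_le ht]
  have hycont : ContinuousOn y (Icc 0 t) := by
    have := hint.absolutelyContinuousOnInterval_integral.continuousOn
    rw [uIcc_of_le ht] at this
    exact (this.const_smul F).const_add α
  have hexp : Continuous fun s : ℝ => Real.exp (-(F * s)) := by fun_prop
  have hanti : AntitoneOn (fun s => y s * Real.exp (-(F * s))) (Icc 0 t) := by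
    have hder : ∀ s ∈ interior (Icc 0 t), HasDerivAt (fun s => y s * Real.exp (-(F * s)))
        (F * φ s * Real.exp (-(F * s)) + y s * (Real.exp (-(F * s)) * -(F * 1))) s := by
      intro s hs
      rw [interior_Icc] at hs
      have hnhds : Icc 0 t ∈ 𝓝 s := Icc_mem_nhds hs.1 hs.2
      have h1 : HasDerivAt (fun s => ∫ r in 0..s, φ r) (φ s) s :=
        intervalIntegral.integral_hasDerivAt_right
          (hint.mono_set (uIcc_subset_uIcc left_mem_uIcc
            (by rw [uIcc_of_le ht]; exact Ioo_subset_Icc_self hs)))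
          (ContinuousOn.stronglyMeasurableAtFilter_nhdsWithin hφ measurableSet_Icc s |>.filter_mono
            (by rw [nhdsWithin_eq_nhds.mpr hnhds]))
          (hφ.continuousAt hnhds)
      exact ((h1.const_mul F).const_add α).mul (((hasDerivAt_id s).const_mul F).neg.exp)
    refine antitoneOn_of_deriv_nonpos (convex_Icc 0 t) (hycont.mul hexp.continuousOn)
      (fun s hs => (hder s hs).differentiableAt.differentiableWithinAt) fun s hs => ?_
    rw [(hder s hs).deriv]
    have h2 := mul_nonneg (mul_nonneg hF (sub_nonneg.mpr (h s (interior_subset hs))))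
      (Real.exp_pos (-(F * s))).le
    nlinarith
  have h0 := hanti (left_mem_Icc.mpr ht) (right_mem_Icc.mpr ht) ht
  simp only [hy, intervalIntegral.integral_same, mul_zero, neg_zero, Real.exp_zero, mul_one,
    add_zero] at h0
  calc φ t ≤ (y t * Real.exp (-(F * t))) * Real.exp (t * F) := by
        rw [mul_assoc, ← Real.exp_add, mul_comm t F, neg_add_cancel, Real.exp_zero, mul_one]
        exact h t (right_mem_Icc.mpr ht)
    _ ≤ α * Real.exp (t * F) := mul_le_mul_of_nonneg_right h0 (Real.exp_pos _).le

theorem norm_add_integral_sq_le {X : Type*} [NormedAddCommGroup X] [NormedSpace ℝ X] {w : ℝ → X}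
    (c : X) {t T : ℝ} (ht : 0 ≤ t) (htT : t ≤ T)
    (hw : IntervalIntegrable w volume 0 t)
    (hw2 : IntervalIntegrable (fun r => ‖w r‖ ^ 2) volume 0 t) :
    ‖c + ∫ r in 0..t, w r‖ ^ 2 ≤ (1 + T) * (‖c‖ ^ 2 + ∫ r in 0..t, ‖w r‖ ^ 2) := by
  rcases ht.eq_or_lt with rfl | ht0
  · simp only [intervalIntegral.integral_same, add_zero]
    nlinarith [sq_nonneg ‖c‖]
  set b : ℝ := ∫ r in 0..t, ‖w r‖ with hb
  set I : ℝ := ∫ r in 0..t, ‖w r‖ ^ 2 with hI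
  have hI0 : 0 ≤ I := intervalIntegral.integral_nonneg ht fun _ _ => sq_nonneg _
  have hb0 : 0 ≤ b := intervalIntegral.integral_nonneg ht fun _ _ => norm_nonneg _
  -- The Cauchy–Schwarz inequality: the variance of `‖w‖` about its mean is nonnegative.
  have hcs : b ^ 2 ≤ t * I := by
    have h1 : 0 ≤ ∫ r in 0..t, (‖w r‖ - b / t) ^ 2 :=
      intervalIntegral.integral_nonneg ht fun _ _ => sq_nonneg _
    have h2 : ∫ r in 0..t, (‖w r‖ - b / t) ^ 2 = I - 2 * (b / t) * b + t * (b / t) ^ 2 := by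
      have h3 : ∀ r, (‖w r‖ - b / t) ^ 2 = ‖w r‖ ^ 2 - 2 * (b / t) * ‖w r‖ + (b / t) ^ 2 :=
        fun r => by ring
      simp only [h3]
      rw [intervalIntegral.integral_add (hw2.sub (hw.norm.const_mul _)) intervalIntegrable_const,
        intervalIntegral.integral_sub hw2 (hw.norm.const_mul _),
        intervalIntegral.integral_const_mul, intervalIntegral.integral_const]
      simp [hI, hb]
    rw [h2] at h1
    have h4 : t * (I - 2 * (b / t) * b + t * (b / t) ^ 2) = t * I - b ^ 2 := by
      field_simp
      ring
    nlinarith [mul_nonneg ht h1]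
  have h5 : ‖c + ∫ r in 0..t, w r‖ ≤ ‖c‖ + b := (norm_add_le _ _).trans
    (by gcongr; exact intervalIntegral.norm_integral_le_integral_norm ht)
  have hT : 0 < T := ht0.trans_le htT
  have h6 : b ^ 2 ≤ T * I := hcs.trans (mul_le_mul_of_nonneg_right htT hI0)
  refine (pow_le_pow_left₀ (norm_nonneg _) h5 2).trans ?_
  refine le_of_mul_le_mul_left ?_ hT
  nlinarith [sq_nonneg (T * ‖c‖ - b), mul_le_mul_of_nonneg_left h6 hT.le]

theorem integral_norm_sq_le_of_eLpNorm_le {X Y : Type*} [NormedAddCommGroup X]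
    [NormedAddCommGroup Y] {f : ℝ → X} {g : ℝ → Y} {C t : ℝ} (hC : 0 ≤ C) (ht : 0 ≤ t)
    (hf : MemLp f 2 (volume.restrict (Ioo 0 t))) (hg : MemLp g 2 (volume.restrict (Ioo 0 t)))
    (h : eLpNorm f 2 (volume.restrict (Ioo 0 t)) ≤
      ENNReal.ofReal C * eLpNorm g 2 (volume.restrict (Ioo 0 t))) :
    ∫ r in 0..t, ‖f r‖ ^ 2 ≤ C ^ 2 * ∫ r in 0..t, ‖g r‖ ^ 2 := by
  rw [hf.eLpNorm_eq_integral_rpow_norm two_ne_zero ENNReal.ofNat_ne_top,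
    hg.eLpNorm_eq_integral_rpow_norm two_ne_zero ENNReal.ofNat_ne_top,
    ← ENNReal.ofReal_mul hC, ENNReal.ofReal_le_ofReal_iff (by positivity)] at h
  simp only [ENNReal.toReal_ofNat, Real.rpow_ofNat, ← one_div, ← Real.sqrt_eq_rpow] at h
  rw [intervalIntegral.integral_of_le ht, intervalIntegral.integral_of_le ht,
    integral_Ioc_eq_integral_Ioo, integral_Ioc_eq_integral_Ioo]
  have h1 := pow_le_pow_left₀ (Real.sqrt_nonneg _) h 2
  rwa [mul_pow, Real.sq_sqrt (integral_nonneg fun _ => sq_nonneg _),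
    Real.sq_sqrt (integral_nonneg fun _ => sq_nonneg _)] at h1

end IntegralInequalities

/-! ### The energy of a time-dependent form -/

section FormEnergy

variable {V H : Type*} [NormedAddCommGroup V] [InnerProductSpace ℝ V]
  [NormedAddCommGroup H] [InnerProductSpace ℝ H]
  {T : ℝ} {ι : V →L[ℝ] H} {a₀ a₁ : ℝ → V →L[ℝ] V →L[ℝ] ℝ} {lam μ C₀ C₀' C₁ : ℝ}

namespace IsAdmissibleForm

theorem abs_sub_le (ha : IsAdmissibleForm T ι a₀ a₁ lam μ C₀ C₀' C₁) {s t : ℝ}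
    (hs : s ∈ Icc 0 T) (ht : t ∈ Icc 0 T) (x y : V) :
    |a₀ t x y - a₀ s x y| ≤ C₀' * ‖x‖ * ‖y‖ * |t - s| :=
  (convex_Icc 0 T).norm_image_sub_le_of_norm_derivWithin_le
    ((ha.contDiff₀ x y).differentiableOn one_ne_zero) (fun r hr => ha.bound₀' r hr x y) hs ht

variable {u' : ℝ → V}

theorem absolutelyContinuousOnInterval_energy
    (ha : IsAdmissibleForm T ι a₀ a₁ lam μ C₀ C₀' C₁) (hT : 0 ≤ T) (f : V)
    (hu' : IntervalIntegrable u' volume 0 T) :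
    AbsolutelyContinuousOnInterval
      (fun t => a₀ t (f + ∫ r in 0..t, u' r) (f + ∫ r in 0..t, u' r)) 0 T := by
  have hU := AbsolutelyContinuousOnInterval.const_add_integral f hu'
  set U : ℝ → V := fun t => f + ∫ r in 0..t, u' r
  obtain ⟨M, hM⟩ := hU.exists_bound
  have hid : AbsolutelyContinuousOnInterval (fun t : ℝ => t) 0 T :=
    ContDiffOn.absolutelyContinuousOnInterval contDiff_id.contDiffOn
  have hM0 : 0 ≤ M := (norm_nonneg _).trans (hM 0 left_mem_uIcc)
  refine hid.of_dist_le_add (A := C₀' * M * M) (B := 2 * C₀ * M) hU fun s hs t ht => ?_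
  have hUs := hM s hs
  have hUt := hM t ht
  rw [uIcc_of_le hT] at hs ht
  have hsplit : a₀ s (U s) (U s) - a₀ t (U t) (U t) = (a₀ s (U s) (U s) - a₀ t (U s) (U s)) +
      (a₀ t (U s) (U s - U t) + a₀ t (U s - U t) (U t)) := by
    simp only [map_sub, sub_apply]
    ring
  rw [Real.dist_eq, Real.dist_eq, dist_eq_norm, hsplit]
  have h1 := ha.abs_sub_le ht hs (U s) (U s)
  have h2 := ha.bound₀ t ht (U s) (U s - U t)
  have h3 := ha.bound₀ t ht (U s - U t) (U t)
  have h4 : C₀' * ‖U s‖ * ‖U s‖ * |s - t| ≤ C₀' * M * M * |s - t| := by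
    have := ha.C₀'_nonneg
    gcongr
  have h5 : C₀ * ‖U s‖ * ‖U s - U t‖ ≤ C₀ * M * ‖U s - U t‖ := by
    have := ha.C₀_nonneg
    gcongr
  have h6 : C₀ * ‖U s - U t‖ * ‖U t‖ ≤ C₀ * ‖U s - U t‖ * M := by
    have := ha.C₀_nonneg
    gcongr
  refine (abs_add_le _ _).trans ((add_le_add h1 (abs_add_le _ _)).trans ?_)
  linarith

/-- The form is not assumed differentiable in operator norm, so its contribution to the derivative
of the energy is only estimated, through difference quotients. -/
theorem ae_deriv_energy_le [CompleteSpace V]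
    (ha : IsAdmissibleForm T ι a₀ a₁ lam μ C₀ C₀' C₁) (hT : 0 ≤ T) (f : V)
    (hu' : IntervalIntegrable u' volume 0 T) :
    ∀ᵐ t, t ∈ Ioo 0 T →
      deriv (fun t => a₀ t (f + ∫ r in 0..t, u' r) (f + ∫ r in 0..t, u' r)) t ≤
        C₀' * ‖f + ∫ r in 0..t, u' r‖ ^ 2 + 2 * a₀ t (f + ∫ r in 0..t, u' r) (u' t) := by
  filter_upwards [(ha.absolutelyContinuousOnInterval_energy hT f hu').ae_differentiableAt,
    hu'.ae_hasDerivAt_const_add_integral f] with x hE hU hx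
  have hxT : x ∈ uIcc 0 T := by
    rw [uIcc_of_le hT]
    exact Ioo_subset_Icc_self hx
  replace hE := (hE hxT).hasDerivAt
  replace hU := hU hxT
  set U : ℝ → V := fun t => f + ∫ r in 0..t, u' r with hUdef
  have hQ : HasDerivAt (fun y => a₀ x (U y) (U y)) (2 * a₀ x (U x) (u' x)) x := by
    have h := (a₀ x).hasDerivAt_of_bilinear (fun _ => hU) (fun _ => hU)
    rwa [ha.symm₀ x (Ioo_subset_Icc_self hx) (u' x), ← two_mul] at h
  have hsub : 𝓝[>] x ≤ 𝓝[≠] x := nhdsWithin_mono x fun y hy => ne_of_gt hy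
  have h1 := (hasDerivAt_iff_tendsto_slope.mp hE).mono_left hsub
  have h2 := (hasDerivAt_iff_tendsto_slope.mp hQ).mono_left hsub
  have h3 : Tendsto (fun y => C₀' * ‖U y‖ ^ 2) (𝓝[>] x) (𝓝 (C₀' * ‖U x‖ ^ 2)) :=
    ((hU.continuousAt.norm.pow 2).const_mul C₀').tendsto.mono_left nhdsWithin_le_nhds
  refine le_of_tendsto_of_tendsto h1 (h3.add h2) ?_
  have hT' : ∀ᶠ y in 𝓝[>] x, y < T := nhdsWithin_le_nhds (Iio_mem_nhds hx.2)
  filter_upwards [self_mem_nhdsWithin, hT'] with y hxy hyT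
  have hxy : 0 < y - x := sub_pos.mpr hxy
  have h4 := (le_abs_self _).trans (ha.abs_sub_le (Ioo_subset_Icc_self hx)
    ⟨hx.1.le.trans (sub_nonneg.mp hxy.le), hyT.le⟩ (U y) (U y))
  rw [abs_of_pos hxy] at h4
  rw [slope_def_field, slope_def_field, ← sub_le_iff_le_add, ← sub_div, div_le_iff₀ hxy]
  linarith

end IsAdmissibleForm

end FormEnergy

/-! ### Square-integrable curves -/

section SquareIntegrable

variable {X Y : Type*} [NormedAddCommGroup X] [NormedAddCommGroup Y] {T : ℝ}

theorem ae_mem_uIcc_of_ae_restrict_Ioo (hT : 0 ≤ T) {P : ℝ → Prop}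
    (h : ∀ᵐ t ∂(volume.restrict (Ioo (0 : ℝ) T)), P t) : ∀ᵐ t, t ∈ uIcc 0 T → P t := by
  rwa [restrict_Ioo_eq_restrict_Icc, ae_restrict_iff' measurableSet_Icc, ← uIcc_of_le hT] at h

theorem MeasureTheory.MemLp.intervalIntegrable_of_Ioo (hT : 0 ≤ T) {f : ℝ → X}
    (hf : MemLp f 2 (volume.restrict (Ioo (0 : ℝ) T))) : IntervalIntegrable f volume 0 T := by
  rw [intervalIntegrable_iff_integrableOn_Ioo_of_le hT]
  exact hf.integrable one_le_two

theorem MeasureTheory.MemLp.intervalIntegrable_mul_of_Ioo (hT : 0 ≤ T) {f : ℝ → X} {g : ℝ → Y}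
    (hf : MemLp f 2 (volume.restrict (Ioo (0 : ℝ) T)))
    (hg : MemLp g 2 (volume.restrict (Ioo (0 : ℝ) T))) :
    IntervalIntegrable (fun t => ‖f t‖ * ‖g t‖) volume 0 T := by
  rw [intervalIntegrable_iff_integrableOn_Ioo_of_le hT]
  exact hf.norm.integrable_mul hg.norm

theorem MeasureTheory.MemLp.intervalIntegrable_sq_of_Ioo (hT : 0 ≤ T) {f : ℝ → X}
    (hf : MemLp f 2 (volume.restrict (Ioo (0 : ℝ) T))) :
    IntervalIntegrable (fun t => ‖f t‖ ^ 2) volume 0 T := by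
  simpa only [pow_two] using hf.intervalIntegrable_mul_of_Ioo hT hf

end SquareIntegrable

/-! ### The energy estimate -/

section EnergyEstimate

variable {V H : Type*} [NormedAddCommGroup V] [InnerProductSpace ℝ V]
  [NormedAddCommGroup H] [InnerProductSpace ℝ H]
  {T : ℝ} {ι : V →L[ℝ] H} {a₀ a₁ : ℝ → V →L[ℝ] V →L[ℝ] ℝ} {lam μ C₀ C₀' C₁ : ℝ}

theorem energyNu_pos (hμ : 0 < μ) : 0 < energyNu μ := lt_min one_pos hμ

/-- Coercivity and Gronwall's inequality turn the integrated energy inequality `henergy` into the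
final bound; `hlower` controls the term `λ ‖ι u‖²` that coercivity leaves behind. -/
theorem IsAdmissibleForm.norm_sq_add_norm_sq_le
    (ha : IsAdmissibleForm T ι a₀ a₁ lam μ C₀ C₀' C₁) (hT : 0 ≤ T) (CL : ℝ) {U : ℝ → V}
    {W : ℝ → H} {k : ℝ → ℝ} (f₁ : V) (f₂ : H) (hU : ContinuousOn U (Icc 0 T))
    (hW : ContinuousOn W (Icc 0 T)) (hk : IntervalIntegrable k volume 0 T) (hk0 : ∀ t, 0 ≤ k t)
    (henergy : ∀ t ∈ Icc 0 T, ‖W t‖ ^ 2 + a₀ t (U t) (U t) ≤ ‖f₂‖ ^ 2 + a₀ 0 f₁ f₁ +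
      ∫ r in 0..t, ((C₀' + C₁ + CL ^ 2) * ‖U r‖ ^ 2 + (C₁ + 2) * ‖W r‖ ^ 2 + k r))
    (hlower : ∀ t ∈ Icc 0 T,
      ‖ι (U t)‖ ^ 2 ≤ (1 + T) * (‖f₁‖ ^ 2 + ∫ r in 0..t, ‖W r‖ ^ 2)) :
    ∀ t ∈ Icc 0 T, ‖U t‖ ^ 2 + ‖W t‖ ^ 2 ≤
      (energyD T lam μ C₀ * ‖f₁‖ ^ 2 + 1 / energyNu μ * (‖f₂‖ ^ 2 + ∫ r in 0..t, k r)) *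
        Real.exp (t * energyF T lam μ C₀' C₁ CL) := by
  intro t ht
  have hν := energyNu_pos ha.mu_pos
  have hlam := ha.lam_pos
  have hC₁ := ha.C₁_nonneg
  have hC₀' := ha.C₀'_nonneg
  have hF : 0 ≤ energyF T lam μ C₀' C₁ CL := le_max_of_le_left (by positivity)
  have hF1 : C₀' + C₁ + CL ^ 2 ≤ energyNu μ * energyF T lam μ C₀' C₁ CL := by
    rw [mul_comm (energyNu μ), ← div_le_iff₀ hν]
    exact le_max_left _ _
  have hF2 : C₁ + 2 + lam * (1 + T) ≤ energyNu μ * energyF T lam μ C₀' C₁ CL := by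
    rw [mul_comm (energyNu μ), ← div_le_iff₀ hν]
    exact le_max_right _ _
  have hD : energyNu μ * energyD T lam μ C₀ = C₀ + lam * (1 + T) := by
    rw [energyD]
    field_simp
  set φ : ℝ → ℝ := fun s => ‖U s‖ ^ 2 + ‖W s‖ ^ 2 with hφ
  have hφc : ContinuousOn φ (Icc 0 T) := (hU.norm.pow 2).add (hW.norm.pow 2)
  have htT : Icc 0 t ⊆ Icc 0 T := Icc_subset_Icc_right ht.2
  refine le_mul_exp_of_le_add_mul_integral (φ := φ) ht.1 hF (hφc.mono htT) fun s hs => ?_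
  have hsT := htT hs
  have hsub : uIcc 0 s ⊆ Icc 0 T := by
    rw [uIcc_of_le hs.1]
    exact Icc_subset_Icc_right hsT.2
  have iU : IntervalIntegrable (fun r => ‖U r‖ ^ 2) volume 0 s :=
    ((hU.norm.pow 2).mono hsub).intervalIntegrable
  have iW : IntervalIntegrable (fun r => ‖W r‖ ^ 2) volume 0 s :=
    ((hW.norm.pow 2).mono hsub).intervalIntegrable
  have ik : ∀ x ∈ Icc 0 T, IntervalIntegrable k volume 0 x := fun x hx =>
    hk.mono_set (by rw [uIcc_of_le hx.1, uIcc_of_le hT]; exact Icc_subset_Icc_right hx.2)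
  have h1 := henergy s hsT
  have h2 := hlower s hsT
  have h3 := ha.coercive s hsT (U s)
  have h4 := (le_abs_self _).trans (ha.bound₀ 0 (left_mem_Icc.mpr hT) f₁ f₁)
  have hkmono : ∫ r in 0..s, k r ≤ ∫ r in 0..t, k r :=
    intervalIntegral.integral_mono_interval le_rfl hs.1 hs.2 (Eventually.of_forall hk0)
      (ik t ht)
  rw [intervalIntegral.integral_add ((iU.const_mul _).add (iW.const_mul _)) (ik s hsT),
    intervalIntegral.integral_add (iU.const_mul _) (iW.const_mul _),
    intervalIntegral.integral_const_mul, intervalIntegral.integral_const_mul] at h1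
  have hφint : ∫ r in 0..s, φ r = (∫ r in 0..s, ‖U r‖ ^ 2) + ∫ r in 0..s, ‖W r‖ ^ 2 :=
    intervalIntegral.integral_add iU iW
  have hIU : 0 ≤ ∫ r in 0..s, ‖U r‖ ^ 2 :=
    intervalIntegral.integral_nonneg hs.1 fun _ _ => sq_nonneg _
  have hIW : 0 ≤ ∫ r in 0..s, ‖W r‖ ^ 2 :=
    intervalIntegral.integral_nonneg hs.1 fun _ _ => sq_nonneg _
  rw [hφint]
  have hν1 : energyNu μ * ‖W s‖ ^ 2 ≤ ‖W s‖ ^ 2 :=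
    mul_le_of_le_one_left (sq_nonneg _) (min_le_left _ _)
  have hν2 : energyNu μ * ‖U s‖ ^ 2 ≤ μ * ‖U s‖ ^ 2 :=
    mul_le_mul_of_nonneg_right (min_le_right _ _) (sq_nonneg _)
  have h5 := mul_le_mul_of_nonneg_left h2 hlam.le
  have h6 := mul_le_mul_of_nonneg_right hF1 hIU
  have h7 := mul_le_mul_of_nonneg_right hF2 hIW
  refine le_of_mul_le_mul_left ?_ hν
  have h8 : energyNu μ * (energyD T lam μ C₀ * ‖f₁‖ ^ 2 +
      1 / energyNu μ * (‖f₂‖ ^ 2 + ∫ r in 0..t, k r) +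
      energyF T lam μ C₀' C₁ CL * ((∫ r in 0..s, ‖U r‖ ^ 2) + ∫ r in 0..s, ‖W r‖ ^ 2)) =
      (C₀ + lam * (1 + T)) * ‖f₁‖ ^ 2 + (‖f₂‖ ^ 2 + ∫ r in 0..t, k r) +
      (energyNu μ * energyF T lam μ C₀' C₁ CL * (∫ r in 0..s, ‖U r‖ ^ 2) +
        energyNu μ * energyF T lam μ C₀' C₁ CL * ∫ r in 0..s, ‖W r‖ ^ 2) := by
    rw [← hD]
    field_simp
  rw [h8]
  simp only [hφ]
  linarith

end EnergyEstimate

/-! ### Solutions of the evolution equation -/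

section Solution

variable {V H : Type*} [NormedAddCommGroup V] [InnerProductSpace ℝ V]
  [NormedAddCommGroup H] [InnerProductSpace ℝ H]
  {T : ℝ} {ι : V →L[ℝ] H} {a₀ a₁ : ℝ → V →L[ℝ] V →L[ℝ] ℝ} {lam μ C₀ C₀' C₁ : ℝ}
  {L : BochnerL2 T H → BochnerL2 T H} {h : BochnerL2 T H} {f₁ : V} {f₂ : H}
  {u u' : BochnerL2 T V} {u'' : BochnerL2 T (StrongDual ℝ V)}

theorem toDual_symm_toDualOf [CompleteSpace V] [CompleteSpace H] (ι : V →L[ℝ] H) (x : H) :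
    (InnerProductSpace.toDual ℝ V).symm (toDualOf ι x) = ContinuousLinearMap.adjoint ι x := by
  refine ext_inner_right ℝ fun v => ?_
  rw [InnerProductSpace.toDual_symm_apply, ContinuousLinearMap.adjoint_inner_left]
  rfl

theorem adjoint_injective_of_denseRange [CompleteSpace V] [CompleteSpace H]
    (hι : DenseRange ι) :
    Function.Injective (ContinuousLinearMap.adjoint ι) := by
  intro x y hxy
  refine Dense.eq_of_inner_left (𝕜 := ℝ) hι ?_
  rintro _ ⟨v, rfl⟩
  rw [← ContinuousLinearMap.adjoint_inner_left, ← ContinuousLinearMap.adjoint_inner_left, hxy]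

namespace IsAbstractSolution

/-- The exceptional null set in the equation can be chosen independently of the test vector. -/
theorem ae_forall_equation [TopologicalSpace.SeparableSpace V]
    (hu : IsAbstractSolution T ι a₀ a₁ L h f₁ f₂ u u' u'') :
    ∀ᵐ t ∂(volume.restrict (Ioo (0 : ℝ) T)), ∀ v : V,
      u'' t v + (a₀ t (u t) v + a₁ t (u t) v) + inner ℝ (L (ι.compLp u) t) (ι v)
        = inner ℝ (h t) (ι v) := by
  filter_upwards [ae_all_iff.mpr fun n => hu.equation (TopologicalSpace.denseSeq V n)] with t ht
  have hl : Continuous fun v : V => u'' t v + (a₀ t (u t) v + a₁ t (u t) v) +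
      inner ℝ (L (ι.compLp u) t) (ι v) := by fun_prop
  have hr : Continuous fun v : V => inner ℝ (h t) (ι v) := by fun_prop
  exact fun v => congrFun
    ((TopologicalSpace.denseRange_denseSeq V).equalizer hl hr (funext ht)) v

theorem ae_eq_add_integral [CompleteSpace V] (hT : 0 < T)
    (hu : IsAbstractSolution T ι a₀ a₁ L h f₁ f₂ u u' u'') :
    ∀ᵐ t ∂(volume.restrict (Ioo (0 : ℝ) T)), u t = f₁ + ∫ r in 0..t, u' r := by
  obtain ⟨g, hg, hg0⟩ := hu.init_u
  have h1 := hu.deriv_u.isContRepr_eq_add_integral hT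
    ((Lp.memLp u).intervalIntegrable_of_Ioo hT.le)
    ((Lp.memLp u').intervalIntegrable_of_Ioo hT.le) hg
  filter_upwards [hg.2, ae_restrict_mem measurableSet_Ioo] with t ht htT
  rw [← ht, h1 t (Ioo_subset_Icc_self htT), hg0]

/-- The velocity has a representative that is continuous in `H`, with the prescribed initial
value, and its squared norm is a primitive of `2 ⟨u'', u'⟩`. -/
theorem exists_velocity [CompleteSpace V] [CompleteSpace H]
    (hι : IsGelfandEmbedding ι) (hT : 0 < T)
    (hu : IsAbstractSolution T ι a₀ a₁ L h f₁ f₂ u u' u'') :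
    ∃ W : ℝ → H, ContinuousOn W (uIcc 0 T) ∧ (∀ᵐ t, t ∈ uIcc 0 T → W t = ι (u' t)) ∧
      W 0 = f₂ ∧ IntervalIntegrable (fun t => 2 * u'' t (u' t)) volume 0 T ∧
      ∀ t ∈ uIcc 0 T, ‖W t‖ ^ 2 - ‖f₂‖ ^ 2 = ∫ r in 0..t, 2 * u'' r (u' r) := by
  obtain ⟨G, hG, hG0⟩ := hu.init_u'
  set R := (InnerProductSpace.toDual ℝ V).symm with hR
  have hu' := Lp.memLp u'
  have hu'' := Lp.memLp u''
  have hu''i := hu''.intervalIntegrable_of_Ioo hT.le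
  have hcanon : MemLp (fun t => toDualOf ι (ι (u' t))) 2 (volume.restrict (Ioo (0 : ℝ) T)) := by
    have hc : (fun t => toDualOf ι (ι (u' t))) =
        fun t => InnerProductSpace.toDual ℝ V (gramOperator ι (u' t)) := by
      funext t
      rw [← LinearIsometryEquiv.symm_apply_eq, toDual_symm_toDualOf]
      rfl
    rw [hc]
    refine MemLp.of_le (((gramOperator ι).comp_memLp' hu')) ?_
      (Eventually.of_forall fun t => (LinearIsometryEquiv.norm_map _ _).le)
    exact (InnerProductSpace.toDual ℝ V).continuous.comp_aestronglyMeasurable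
      ((gramOperator ι).continuous.comp_aestronglyMeasurable hu'.1)
  have hGint := hu.deriv_u'.isContRepr_eq_add_integral hT
    (hcanon.intervalIntegrable_of_Ioo hT.le) hu''i hG
  set p : ℝ → V := fun t => R (u'' t) with hp
  have hpL : MemLp p 2 (volume.restrict (Ioo (0 : ℝ) T)) :=
    MemLp.of_le hu'' (R.continuous.comp_aestronglyMeasurable hu''.1)
      (Eventually.of_forall fun t => by rw [hp, LinearIsometryEquiv.norm_map])
  have hpi := hpL.intervalIntegrable_of_Ioo hT.le
  have hpairing : ∀ t, inner ℝ (u' t) (p t) = u'' t (u' t) := fun t => by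
    rw [real_inner_comm]
    exact InnerProductSpace.toDual_symm_apply
  have hg : ∀ t ∈ uIcc 0 T, R (G t) = R (G 0) + ∫ r in 0..t, p r := by
    intro t ht
    have hsub : uIcc 0 t ⊆ uIcc 0 T := uIcc_subset_uIcc left_mem_uIcc ht
    rw [uIcc_of_le hT.le] at ht
    rw [hGint t ht, map_add]
    congr 1
    refine ext_inner_left ℝ fun v => ?_
    rw [real_inner_comm, InnerProductSpace.toDual_symm_apply,
      ContinuousLinearMap.intervalIntegral_apply (hu''i.mono_set hsub)]
    have h1 := (innerSL ℝ v).intervalIntegral_comp_comm (hpi.mono_set hsub)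
    simp only [innerSL_apply_apply] at h1
    rw [← h1]
    refine intervalIntegral.integral_congr fun r _ => ?_
    change u'' r v = inner ℝ v (R (u'' r))
    rw [real_inner_comm, InnerProductSpace.toDual_symm_apply]
  have hgw : ∀ᵐ t, t ∈ uIcc 0 T → R (G t) = gramOperator ι (u' t) := by
    refine ae_mem_uIcc_of_ae_restrict_Ioo hT.le (hG.2.mono fun t ht => ?_)
    rw [ht, toDual_symm_toDualOf]
    rfl
  have hmeas : AEStronglyMeasurable u' (volume.restrict (uIoc 0 T)) := by
    rw [uIoc_of_le hT.le, ← restrict_Ioo_eq_restrict_Ioc]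
    exact hu'.1
  have hprod := hu'.intervalIntegrable_mul_of_Ioo hT.le hpL
  obtain ⟨W, hWc, hWae, hWg, hWe⟩ := exists_continuousOn_eq_and_energy_identity hι.injective hT
    (g := fun t => R (G t)) hmeas hpi hprod hg hgw
  have hW0 : W 0 = f₂ := by
    refine adjoint_injective_of_denseRange hι.dense ?_
    rw [hWg 0 left_mem_uIcc, hG0, toDual_symm_toDualOf]
  refine ⟨W, hWc, hWae, hW0, ?_, fun t ht => ?_⟩
  · simp only [← hpairing]
    refine IntervalIntegrable.const_mul ?_ 2
    exact hprod.mono_fun (hmeas.inner (intervalIntegrable_iff.mp hpi).aestronglyMeasurable)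
      (Eventually.of_forall fun t => (norm_inner_le_norm _ _).trans (le_abs_self _))
  · have h1 := hWe t ht
    simp only [hpairing, hW0] at h1
    exact h1

end IsAbstractSolution

end Solution

theorem CausalBound.integral_norm_sq_le {H : Type*} [NormedAddCommGroup H] {T CL : ℝ}
    {L : BochnerL2 T H → BochnerL2 T H} (hL : CausalBound T L CL) (hCL : 0 ≤ CL)
    (v : BochnerL2 T H) {t : ℝ} (ht : t ∈ Icc 0 T) :
    ∫ r in 0..t, ‖L v r‖ ^ 2 ≤ CL ^ 2 * ∫ r in 0..t, ‖v r‖ ^ 2 := by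
  rcases ht.1.eq_or_lt with rfl | ht0
  · simp
  · have hle : volume.restrict (Ioo 0 t) ≤ volume.restrict (Ioo 0 T) :=
      Measure.restrict_mono (Ioo_subset_Ioo_right ht.2) le_rfl
    exact integral_norm_sq_le_of_eLpNorm_le hCL ht.1 ((Lp.memLp (L v)).mono_measure hle)
      ((Lp.memLp v).mono_measure hle) (hL t ⟨ht0, ht.2⟩ v)

section EnergyInequality

variable {V H : Type*} [NormedAddCommGroup V] [InnerProductSpace ℝ V]
  [NormedAddCommGroup H] [InnerProductSpace ℝ H]
  {T : ℝ} {ι : V →L[ℝ] H} {a₀ a₁ : ℝ → V →L[ℝ] V →L[ℝ] ℝ} {lam μ C₀ C₀' C₁ : ℝ}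
  {L : BochnerL2 T H → BochnerL2 T H} {CL : ℝ} {h : BochnerL2 T H} {f₁ : V} {f₂ : H}
  {u u' : BochnerL2 T V} {u'' : BochnerL2 T (StrongDual ℝ V)}

/-- Testing the equation with the velocity and integrating in time. -/
theorem IsAbstractSolution.energy_le [CompleteSpace V] [CompleteSpace H]
    [TopologicalSpace.SeparableSpace V] (hι : ∀ v, ‖ι v‖ ≤ ‖v‖) (hT : 0 < T)
    (ha : IsAdmissibleForm T ι a₀ a₁ lam μ C₀ C₀' C₁) (hCL : 0 ≤ CL) (hL : CausalBound T L CL)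
    (hu : IsAbstractSolution T ι a₀ a₁ L h f₁ f₂ u u' u'') {U : ℝ → V} {W : ℝ → H}
    (hUdef : U = fun t => f₁ + ∫ r in 0..t, u' r)
    (hW : ContinuousOn W (uIcc 0 T)) (hWae : ∀ᵐ t, t ∈ uIcc 0 T → W t = ι (u' t))
    (hint : IntervalIntegrable (fun t => 2 * u'' t (u' t)) volume 0 T)
    (hWe : ∀ t ∈ uIcc 0 T, ‖W t‖ ^ 2 - ‖f₂‖ ^ 2 = ∫ r in 0..t, 2 * u'' r (u' r)) :
    ∀ t ∈ Icc 0 T, ‖W t‖ ^ 2 + a₀ t (U t) (U t) ≤ ‖f₂‖ ^ 2 + a₀ 0 f₁ f₁ +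
      ∫ r in 0..t, ((C₀' + C₁ + CL ^ 2) * ‖U r‖ ^ 2 + (C₁ + 2) * ‖W r‖ ^ 2 + ‖h r‖ ^ 2) := by
  intro t ht
  have hu'i := (Lp.memLp u').intervalIntegrable_of_Ioo hT.le
  have hE := ha.absolutelyContinuousOnInterval_energy hT.le f₁ hu'i
  have hEd := ha.ae_deriv_energy_le hT.le f₁ hu'i
  have hUc := (AbsolutelyContinuousOnInterval.const_add_integral f₁ hu'i).continuousOn
  have hUu := ae_mem_uIcc_of_ae_restrict_Ioo hT.le (hu.ae_eq_add_integral hT)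
  simp only [← hUdef] at hUc
  have hUx : ∀ x, f₁ + ∫ r in 0..x, u' r = U x := fun x => by rw [hUdef]
  simp only [hUx] at hE hEd hUu
  set E : ℝ → ℝ := fun t => a₀ t (U t) (U t) with hEdef
  have hE0 : E 0 = a₀ 0 f₁ f₁ := by simp [hEdef, hUdef]
  have ht' : t ∈ uIcc 0 T := by rwa [uIcc_of_le hT.le]
  have hsub : uIcc 0 t ⊆ uIcc 0 T := uIcc_subset_uIcc left_mem_uIcc ht'
  have iU : IntervalIntegrable (fun r => ‖U r‖ ^ 2) volume 0 t :=
    ((hUc.norm.pow 2).mono hsub).intervalIntegrable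
  have iW : IntervalIntegrable (fun r => ‖W r‖ ^ 2) volume 0 t :=
    ((hW.norm.pow 2).mono hsub).intervalIntegrable
  have ih : IntervalIntegrable (fun r => ‖h r‖ ^ 2) volume 0 t :=
    ((Lp.memLp h).intervalIntegrable_sq_of_Ioo hT.le).mono_set hsub
  set v : BochnerL2 T H := ι.compLp u with hv
  have iL : IntervalIntegrable (fun r => ‖L v r‖ ^ 2) volume 0 t :=
    ((Lp.memLp (L v)).intervalIntegrable_sq_of_Ioo hT.le).mono_set hsub
  have iv : IntervalIntegrable (fun r => ‖v r‖ ^ 2) volume 0 t :=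
    ((Lp.memLp v).intervalIntegrable_sq_of_Ioo hT.le).mono_set hsub
  have ip := hint.mono_set hsub
  have iE := (hE.mono hsub).intervalIntegrable_deriv
  have hsum : ‖W t‖ ^ 2 + E t = ‖f₂‖ ^ 2 + E 0 +
      ∫ r in 0..t, (2 * u'' r (u' r) + deriv E r) := by
    rw [intervalIntegral.integral_add ip iE, ← hWe t ht',
      (hE.mono hsub).integral_deriv_eq_sub]
    ring
  have hvU : ∀ᵐ r, r ∈ uIcc 0 T → v r = ι (U r) := by
    filter_upwards [ae_mem_uIcc_of_ae_restrict_Ioo hT.le (ι.coeFn_compLp u), hUu] with r h1 h2 hr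
    rw [← h2 hr]
    exact h1 hr
  have hae : ∀ P : ℝ → Prop, (∀ᵐ r, r ∈ uIcc 0 T → P r) →
      ∀ᵐ r ∂(volume.restrict (Icc 0 t)), P r := fun P hP => by
    rw [ae_restrict_iff' measurableSet_Icc]
    exact hP.mono fun r h1 hr => h1 (hsub (by rwa [uIcc_of_le ht.1]))
  have hEd' : ∀ᵐ r ∂(volume.restrict (Icc 0 t)),
      deriv E r ≤ C₀' * ‖U r‖ ^ 2 + 2 * a₀ r (U r) (u' r) := by
    have h1 : ∀ᵐ r ∂(volume.restrict (Ioo (0 : ℝ) T)),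
        deriv E r ≤ C₀' * ‖U r‖ ^ 2 + 2 * a₀ r (U r) (u' r) := by
      rwa [ae_restrict_iff' measurableSet_Ioo]
    exact hae _ (ae_mem_uIcc_of_ae_restrict_Ioo hT.le h1)
  have hmono : ∫ r in 0..t, (2 * u'' r (u' r) + deriv E r) ≤
      ∫ r in 0..t, ((C₀' + C₁) * ‖U r‖ ^ 2 + (C₁ + 2) * ‖W r‖ ^ 2 + ‖h r‖ ^ 2 +
        ‖L v r‖ ^ 2) := by
    refine intervalIntegral.integral_mono_ae_restrict ht.1 (ip.add iE)
      ((((iU.const_mul _).add (iW.const_mul _)).add ih).add iL) ?_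
    filter_upwards [hEd', hae _ hUu, hae _ hWae, ae_restrict_mem measurableSet_Icc,
      hae _ (ae_mem_uIcc_of_ae_restrict_Ioo hT.le hu.ae_forall_equation)] with r h1 h2 h3 h4 h5
    have heq := h5 (u' r)
    rw [h2, ← h3] at heq
    have hrT : r ∈ Icc 0 T := Icc_subset_Icc_right ht.2 h4
    have hb := (neg_abs_le _).trans' (neg_le_neg (ha.bound₁ r hrT (U r) (u' r)))
    rw [← h3] at hb
    have hi1 := (abs_real_inner_le_norm (h r) (W r)).trans' (le_abs_self _)
    have hi2 := (neg_abs_le (inner ℝ (L v r) (W r))).trans'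
      (neg_le_neg (abs_real_inner_le_norm (L v r) (W r)))
    have hab : 2 * (C₁ * ‖U r‖ * ‖W r‖) ≤ C₁ * (‖U r‖ ^ 2 + ‖W r‖ ^ 2) := by
      have := mul_le_mul_of_nonneg_left (two_mul_le_add_sq ‖U r‖ ‖W r‖) ha.C₁_nonneg
      linarith
    have hhW := two_mul_le_add_sq ‖h r‖ ‖W r‖
    have hLW := two_mul_le_add_sq ‖L v r‖ ‖W r‖
    change 2 * u'' r (u' r) + deriv E r ≤ _
    linarith
  have hLint := hL.integral_norm_sq_le hCL v ht
  have hvint : ∫ r in 0..t, ‖v r‖ ^ 2 ≤ ∫ r in 0..t, ‖U r‖ ^ 2 := by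
    refine intervalIntegral.integral_mono_ae_restrict ht.1 iv iU ?_
    filter_upwards [hae _ hvU] with r hr
    rw [hr]
    exact pow_le_pow_left₀ (norm_nonneg _) (hι _) 2
  have hCLint := mul_le_mul_of_nonneg_left hvint (sq_nonneg CL)
  change ‖W t‖ ^ 2 + E t ≤ _
  rw [hsum, hE0]
  rw [intervalIntegral.integral_add (((iU.const_mul _).add (iW.const_mul _)).add ih) iL,
    intervalIntegral.integral_add ((iU.const_mul _).add (iW.const_mul _)) ih,
    intervalIntegral.integral_add (iU.const_mul _) (iW.const_mul _),
    intervalIntegral.integral_const_mul, intervalIntegral.integral_const_mul] at hmono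
  rw [intervalIntegral.integral_add ((iU.const_mul _).add (iW.const_mul _)) ih,
    intervalIntegral.integral_add (iU.const_mul _) (iW.const_mul _),
    intervalIntegral.integral_const_mul, intervalIntegral.integral_const_mul]
  linarith

end EnergyInequality

theorem mainTheorem5
    {V H : Type*} [NormedAddCommGroup V] [InnerProductSpace ℝ V] [CompleteSpace V]
    [TopologicalSpace.SeparableSpace V]
    [NormedAddCommGroup H] [InnerProductSpace ℝ H] [CompleteSpace H]
    [TopologicalSpace.SeparableSpace H]
    (ι : V →L[ℝ] H) (hι : IsGelfandEmbedding ι)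
    (T : ℝ) (hT : 0 < T)
    (a₀ a₁ : ℝ → V →L[ℝ] V →L[ℝ] ℝ) (lam μ C₀ C₀' C₁ : ℝ)
    (ha : IsAdmissibleForm T ι a₀ a₁ lam μ C₀ C₀' C₁)
    (L : BochnerL2 T H → BochnerL2 T H) (CL : ℝ) (hCL : 0 < CL) (hL : CausalBound T L CL)
    (f₁ : V) (f₂ : H) (h : BochnerL2 T H)
    (u u' : BochnerL2 T V) (u'' : BochnerL2 T (StrongDual ℝ V))
    (hu : IsAbstractSolution T ι a₀ a₁ L h f₁ f₂ u u' u'') :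
    ∃ (U : ℝ → V) (W : ℝ → H),
      IsContRepr T U u ∧ IsContRepr T W (fun t => ι (u' t)) ∧
      ∀ t ∈ Icc 0 T,
        ‖U t‖ ^ 2 + ‖W t‖ ^ 2 ≤
          (energyD T lam μ C₀ * ‖f₁‖ ^ 2
            + 1 / energyNu μ * (‖f₂‖ ^ 2 + ∫ τ in (0 : ℝ)..t, ‖h τ‖ ^ 2))
          * Real.exp (t * energyF T lam μ C₀' C₁ CL) := by
  obtain ⟨W, hWc, hWae, hW0, hint, hWe⟩ := hu.exists_velocity hι hT
  have hu'i := (Lp.memLp u').intervalIntegrable_of_Ioo hT.le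
  have hu'2 := (Lp.memLp u').intervalIntegrable_sq_of_Ioo hT.le
  set U : ℝ → V := fun t => f₁ + ∫ r in 0..t, u' r with hU
  have hUc : ContinuousOn U (uIcc 0 T) :=
    (AbsolutelyContinuousOnInterval.const_add_integral f₁ hu'i).continuousOn
  have hen := hu.energy_le hι.norm_le hT ha hCL.le hL hU hWc hWae hint hWe
  have huIcc : uIcc 0 T = Icc 0 T := uIcc_of_le hT.le
  refine ⟨U, W, ⟨huIcc ▸ hUc, ?_⟩, ⟨huIcc ▸ hWc, ?_⟩, ?_⟩
  · filter_upwards [hu.ae_eq_add_integral hT] with t ht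
    exact ht.symm
  · rw [ae_restrict_iff' measurableSet_Ioo]
    filter_upwards [hWae] with t ht htT
    exact ht (huIcc ▸ Ioo_subset_Icc_self htT)
  · refine ha.norm_sq_add_norm_sq_le hT.le CL f₁ f₂ (huIcc ▸ hUc) (huIcc ▸ hWc)
      ((Lp.memLp h).intervalIntegrable_sq_of_Ioo hT.le) (fun _ => sq_nonneg _) hen fun t ht => ?_
    have ht' : t ∈ uIcc 0 T := huIcc ▸ ht
    have hsub : uIcc 0 t ⊆ uIcc 0 T := uIcc_subset_uIcc left_mem_uIcc ht'
    have hι2 := (ι.comp_memLp' (Lp.memLp u'))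
    have hlow := norm_add_integral_sq_le (ι f₁) ht.1 ht.2
      ((hι2.intervalIntegrable_of_Ioo hT.le).mono_set hsub)
      ((hι2.intervalIntegrable_sq_of_Ioo hT.le).mono_set hsub)
    have h1 : ι (U t) = ι f₁ + ∫ r in 0..t, ι (u' r) := by
      rw [ι.intervalIntegral_comp_comm (hu'i.mono_set hsub), hU, map_add]
    have h2 : ∫ r in 0..t, ‖ι (u' r)‖ ^ 2 = ∫ r in 0..t, ‖W r‖ ^ 2 := by
      refine intervalIntegral.integral_congr_ae ?_
      filter_upwards [hWae] with r hr hrt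
      rw [hr (hsub (uIoc_subset_uIcc hrt))]
    rw [h1, ← h2]
    refine hlow.trans ?_
    have h3 := pow_le_pow_left₀ (norm_nonneg _) (hι.norm_le f₁) 2
    have hT1 : 0 ≤ 1 + T := by linarith
    exact mul_le_mul_of_nonneg_left (by simpa using h3) hT1
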